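/- **Setting.** Let $\mathcal G=(\mathcal V,\mathcal E)$ be a strongly connected digraph without self-loops on $I\ge 1$ agents; $(j,i)\in\mathcal E$ means that $j$ can send to $i$; $\mathcal N_i^{\rm in}=\{j:(j,i)\in\mathcal E\}$, $\mathcal N_i^{\rm out}=\{j:(i,j)\in\mathcal E\}$. Let $\bar m>0$, let $T,D$ be positive integers, $L_i\ge 0$ ($i\in\mathcal V$) and $\tau>0$, and put $$K_1=(2I-1)T+ID,\qquad \eta=\bar m^{K_1},\qquad \rho=(1-\bar m^{K_1})^{1/K_1}.$$ Let $W=(w_{ij})$ and $A=(a_{ij})$ be $I\times I$ real matrices such that, for $M=W$ and $M=A$, $m_{ii}\ge\bar m$ for all $i$, $m_{ij}\ge\bar m$ if $(j,i)\in\mathcal E$, and $m_{ij}=0$ otherwise; $W$ is row-stochastic and $A$ is column-stochastic. Let $f_i:\mathbb R^n\to\mathbb R$ be differentiable with $L_i$-Lipschitz gradient (not necessarily convex), and let $F=\sum_{i} f_i$ be $\tau$-strongly convex. *Asynchronous model.* At each iteration $k\ge 0$ one agent $i^k$ is active and uses data of its in-neighbors with delays $d_j^k$, where $\{i^k,\dots,i^{k+T-1}\}=\mathcal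 V$ for all $k$, and $0\le d_j^k\le D$ for all $k$ and $j\in\mathcal N_{i^k}^{\rm in}$. *ASY-SONATA with step sizes $\gamma^k$.* Start from arbitrary $x_i^0\in\mathbb R^n$, $z_i^0=\nabla f_i(x_i^0)$ and, for $j\in\mathcal N_i^{\rm in}$, $\tilde\rho_{ij}^0=0$, $\tau_{ij}^{-1}=-D$; and $v_i^t=0$, $\rho_{ij}^t=0$ for $t=-D,\dots,0$. At iteration $k$, with $i=i^k$: $$\tau_{ij}^k=\max(\tau_{ij}^{k-1},k-d_j^k)\ (j\in\mathcal N_i^{\rm in}),\qquad v_i^{k+1}=x_i^k-\gamma^k z_i^k,\qquad x_i^{k+1}=w_{ii}v_i^{k+1}+\sum_{j\in\mathcal N_i^{\rm in}}w_{ij}v_j^{\tau_{ij}^k},$$ $$z_i^{k+1/2}=z_i^k+\sum_{j\in\mathcal N_i^{\rm in}}\bigl(\rho_{ij}^{\tau_{ij}^k}-\tilde\rho_{ij}^k\bigr)+\nabla f_i(x_i^{k+1})-\nabla f_i(x_i^k),\qquad z_i^{k+1}=a_{ii}z_i^{k+1/2},$$ $$\rho_{ji}^{k+1}=\rho_{ji}^k+a_{ji}z_i^{k+1/2}\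 (j\in\mathcal N_i^{\rm out}),\qquad \tilde\rho_{ij}^{k+1}=\rho_{ij}^{\tau_{ij}^k}\ (j\in\mathcal N_i^{\rm in}),$$ and all other variables keep their values. **Theorem.** There exist constants $0<\hat\gamma_1<\hat\gamma_2<\bar\gamma_1$ and, for each $\gamma\in(0,\bar\gamma_1]$, a number $\lambda=\lambda(\gamma)$, all depending only on $\mathcal G$, $\bar m$, $T$, $D$, $(L_i)_i$ and $\tau$, such that with $J_1=(1-\rho)^2/\hat\gamma_2$ $$\lambda(\gamma)=\begin{cases}1-\dfrac{\tau\eta^{2}\gamma}{2}&\text{if }\gamma\in(0,\hat\gamma_1],\\[1ex] \rho+\sqrt{J_1\gamma}&\text{if }\gamma\in(\hat\gamma_1,\hat\gamma_2),\end{cases}$$ and, for all $W,A$ as above, $\lambda(\gamma)\in(0,1)$ for every $\gamma\in(0,\bar\gamma_1]$, and for all $n$ and $(f_i)_i$ as above the following holds: $F$ has a unique minimizer $x^\star$, and for all activations and delays as above, every $\gamma\in(0,\bar\gamma_1]$ and every sequence generated by ASY-SONATA with the constant step size $\gamma^k\equiv\gamma$, $$\Bigl(\sum_{i\in\mathcal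 V}\|x_i^k-x^\star\|^2\Bigr)^{1/2}=\|x^k-\mathbf 1_I\otimes x^\star\|=\mathcal O(\lambda(\gamma)^k)\qquad(k\to\infty).$$ -/

import Mathlib

open scoped NNReal
open Filter Asymptotics

namespace AsySonata

/-- The digraph has no self-loops. `G.Adj i j` means that agent `i` can send to agent `j`. -/
def NoSelfLoops {V : Type*} (G : Digraph V) : Prop := ∀ i, ¬ G.Adj i i

/-- Every ordered pair of nodes is joined by a directed path. -/
def StronglyConnected {V : Type*} (G : Digraph V) : Prop :=
  ∀ i j, Relation.ReflTransGen G.Adj i j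

open Classical in
/-- The set of in-neighbors of `i`, i.e. the agents `j` with an edge from `j` to `i`. -/
noncomputable def inNbrs {V : Type*} [Fintype V] (G : Digraph V) (i : V) : Finset V :=
  Finset.univ.filter (fun j => G.Adj j i)

/-- The sparsity pattern of a weight matrix matches the digraph, with positive entries at least
`mbar`. -/
structure Compliant {V : Type*} (G : Digraph V) (mbar : ℝ) (M : Matrix V V ℝ) : Prop where
  diag : ∀ i, mbar ≤ M i i
  edge : ∀ i j, G.Adj j i → mbar ≤ M i j
  zero : ∀ i j, i ≠ j → ¬ G.Adj j i → M i j = 0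

/-- `W` and `A` are compliant with the digraph (with the same `mbar`), `W` is row-stochastic and
`A` is column-stochastic. -/
structure Weights {V : Type*} [Fintype V] (G : Digraph V) (mbar : ℝ) (W A : Matrix V V ℝ) :
    Prop where
  compliantW : Compliant G mbar W
  compliantA : Compliant G mbar A
  rowStochastic : ∀ i, ∑ j, W i j = 1
  colStochastic : ∀ j, ∑ i, A i j = 1

/-- The asynchronous model: `act k` is the agent that triggers the update `k → k + 1`, and
`d k j` is the delay of the information from its in-neighbor `j`. Every agent is active at least
once in each window of `T` iterations, and the delays are at most `D`. -/
structure AsyncModel {V : Type*} [Fintype V] (G : Digraph V) (T D : ℕ) (act : ℕ → V)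
    (d : ℕ → V → ℕ) : Prop where
  activation : ∀ k : ℕ, ∀ i : V, ∃ t, k ≤ t ∧ t < k + T ∧ act t = i
  delay : ∀ k : ℕ, ∀ j ∈ inNbrs G (act k), d k j ≤ D

/-- The variables of the algorithm. The variables which are read with a delay are indexed by
integer times (only times at least `-D` matter), the others by the iteration counter.
`rho t i j` is the cumulative mass generated by `j` for `i`, `rhoBuf k i j` the buffer of `i` for
the mass received from `j`, `zHalf k` the intermediate mass of the agent active at iteration `k`,
and `age k i j` the time stamp of the data of `j` held by `i` just before iteration `k`
(so the time stamp used at iteration `k` is `age (k + 1) i j`). -/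
structure Variables (V E : Type*) where
  x : ℕ → V → E
  v : ℤ → V → E
  z : ℕ → V → E
  zHalf : ℕ → E
  rho : ℤ → V → V → E
  rhoBuf : ℕ → V → V → E
  age : ℕ → V → V → ℤ

/-- `s` is a sequence generated by ASY-SONATA with local costs `f`, weight matrices `W`, `A`,
step-size sequence `step`, activations `act` and delays `d` (bounded by `D`). The starting points
`s.x 0 i` are arbitrary. -/
structure IsGenerated {V : Type*} [Fintype V] {n : ℕ} (G : Digraph V) (W A : Matrix V V ℝ)
    (f : V → EuclideanSpace ℝ (Fin n) → ℝ) (D : ℕ) (step : ℕ → ℝ) (act : ℕ → V)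
    (d : ℕ → V → ℕ) (s : Variables V (EuclideanSpace ℝ (Fin n))) : Prop where
  -- initialization
  z_init : ∀ i, s.z 0 i = gradient (f i) (s.x 0 i)
  v_init : ∀ t : ℤ, -(D : ℤ) ≤ t → t ≤ 0 → ∀ i, s.v t i = 0
  rho_init : ∀ t : ℤ, -(D : ℤ) ≤ t → t ≤ 0 → ∀ i, ∀ j ∈ inNbrs G i, s.rho t i j = 0
  rhoBuf_init : ∀ i, ∀ j ∈ inNbrs G i, s.rhoBuf 0 i j = 0
  age_init : ∀ i, ∀ j ∈ inNbrs G i, s.age 0 i j = -(D : ℤ)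
  -- the active agent purges old information
  age_step : ∀ k : ℕ, ∀ j ∈ inNbrs G (act k),
    s.age (k + 1) (act k) j = max (s.age k (act k) j) ((k : ℤ) - (d k j : ℤ))
  -- local descent
  v_step : ∀ k : ℕ, s.v ((k : ℤ) + 1) (act k) = s.x k (act k) - step k • s.z k (act k)
  -- consensus
  x_step : ∀ k : ℕ, s.x (k + 1) (act k) =
    W (act k) (act k) • s.v ((k : ℤ) + 1) (act k) +
      ∑ j ∈ inNbrs G (act k), W (act k) j • s.v (s.age (k + 1) (act k) j) j
  -- gradient tracking: sum step
  zHalf_step : ∀ k : ℕ, s.zHalf k = s.z k (act k) +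
    ∑ j ∈ inNbrs G (act k),
      (s.rho (s.age (k + 1) (act k) j) (act k) j - s.rhoBuf k (act k) j) +
    (gradient (f (act k)) (s.x (k + 1) (act k)) - gradient (f (act k)) (s.x k (act k)))
  -- gradient tracking: push step
  z_step : ∀ k : ℕ, s.z (k + 1) (act k) = A (act k) (act k) • s.zHalf k
  rho_step : ∀ k : ℕ, ∀ j, G.Adj (act k) j →
    s.rho ((k : ℤ) + 1) j (act k) = s.rho (k : ℤ) j (act k) + A j (act k) • s.zHalf k
  -- gradient tracking: mass-buffer update
  rhoBuf_step : ∀ k : ℕ, ∀ j ∈ inNbrs G (act k),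
    s.rhoBuf (k + 1) (act k) j = s.rho (s.age (k + 1) (act k) j) (act k) j
  -- untouched variables keep their values
  age_keep : ∀ k : ℕ, ∀ i, i ≠ act k → ∀ j ∈ inNbrs G i, s.age (k + 1) i j = s.age k i j
  v_keep : ∀ k : ℕ, ∀ i, i ≠ act k → s.v ((k : ℤ) + 1) i = s.v (k : ℤ) i
  x_keep : ∀ k : ℕ, ∀ i, i ≠ act k → s.x (k + 1) i = s.x k i
  z_keep : ∀ k : ℕ, ∀ i, i ≠ act k → s.z (k + 1) i = s.z k i
  rho_keep : ∀ k : ℕ, ∀ i, i ≠ act k → ∀ j, G.Adj i j →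
    s.rho ((k : ℤ) + 1) j i = s.rho (k : ℤ) j i
  rhoBuf_keep : ∀ k : ℕ, ∀ i, i ≠ act k → ∀ j ∈ inNbrs G i, s.rhoBuf (k + 1) i j = s.rhoBuf k i j

/-- `K₁ = (2 I - 1) T + I D`, where `I` is the number of agents. -/
def K1 (I T D : ℕ) : ℕ := (2 * I - 1) * T + I * D

/-- `η = mbar ^ K₁`. -/
noncomputable def eta (mbar : ℝ) (I T D : ℕ) : ℝ := mbar ^ K1 I T D

/-- `ρ = (1 - mbar ^ K₁) ^ (1 / K₁)`. -/
noncomputable def rhoConst (mbar : ℝ) (I T D : ℕ) : ℝ :=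
  (1 - eta mbar I T D) ^ (1 / (K1 I T D : ℝ))

/-- The stacked Euclidean distance `‖x - 1 ⊗ xs‖` of the local copies to the point `xs`. -/
noncomputable def distToConsensus {V : Type*} [Fintype V] {n : ℕ}
    (x : V → EuclideanSpace ℝ (Fin n)) (xs : EuclideanSpace ℝ (Fin n)) : ℝ :=
  Real.sqrt (∑ i, ‖x i - xs‖ ^ 2)

end AsySonata

open AsySonata

/-!
Both halves of ASY-SONATA are linear recursions with an input at the active agent, once the data in
transit is added to the state. Averaging with delays acts by row-stochastic matrices on the
iterates and the descent variables of the last `D + 1` times (`consensusMatrix`), with input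
`-γ • z`. Gradient tracking acts by column-stochastic matrices on the masses of the agents and the
masses on the edges, sorted by the time since they were sent (`trackingMatrix`), with the change of
the local gradient as input. Along the paths of the strongly connected digraph, over a window of
`K₁` iterations each agent influences all nodes of the first system, and receives from all nodes of
the second one, with a weight of at least `η = mbar ^ K₁` (`eta_le_transition_consensusMatrix`,
`eta_le_transition_trackingMatrix`).

By Doeblin's argument, the diameter of the first state and the `ℓ¹` distance of the second one from
a multiple `ξ k` of the total gradient then contract by `1 - η` per window, up to the inputs
(`IsGenerated.diam_consensusState_le`, `IsGenerated.exists_tracking_error`). Weights `ψ k`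
transported backwards from a finite horizon give an average of the first state which moves by
`-γ * ψ k • z` (`IsGenerated.exists_average`). At the active agent both `ψ k` and, for `k ≥ K₁`,
`ξ k` are at least `η`, and `z` is about `ξ k` times the gradient of `F` at the average, so that
the average makes a perturbed gradient step of length between `η ^ 2 * γ` and `γ`. By strong
convexity this contracts the distance to the minimizer by `1 - 3/4 * τ * η ^ 2 * γ`
(`norm_gradient_step_le`). The consensus and tracking errors are of relative order `γ`, and they
enter multiplied by `γ`, so for small `γ` they use up only a part of this gain and the rate
`1 - τ * η ^ 2 * γ / 2` remains (`exists_stepsize_linear_rate`, `exists_stepsize_isBigO`).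

This holds up to some threshold `γbar`. The second curve `ρ + √(J₁ * γ)` is equal to `1` at its end
`γ₂`, so with `γ₂ = γbar / 2` it crosses the line `1 - τ * η ^ 2 * γ / 2` at some `γ₁ < γ₂` and is
above it from there on (`exists_rate_crossing`): between `γ₁` and `γ₂` it is the weaker bound.
-/

namespace AsySonata

/-! ### Gradient steps for strongly convex functions -/

section StrongConvexity
open Topology
variable {E : Type*} [NormedAddCommGroup E] [InnerProductSpace ℝ E] [CompleteSpace E]

/-- The quadratic lower bound of a strongly convex function by its gradient. -/
lemma strongConvexOn_gradient_le {F : E → ℝ} {τ : ℝ} (hF : StrongConvexOn Set.univ τ F) {x g : E}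
    (hg : HasGradientAt F g x) (y : E) : F x + inner ℝ g (y - x) + τ / 2 * ‖y - x‖ ^ 2 ≤ F y := by
  have hline : HasDerivAt (fun t : ℝ => x + t • (y - x)) (y - x) 0 := by
    simpa using ((hasDerivAt_id (0 : ℝ)).smul_const (y - x)).const_add x
  have hφ : HasDerivAt (fun t : ℝ => F (x + t • (y - x))) (inner ℝ g (y - x)) 0 := by
    have h0 : HasFDerivAt F (InnerProductSpace.toDual ℝ E g) (x + (0 : ℝ) • (y - x)) := by
      simpa using hg.hasFDerivAt
    simpa [Function.comp_def] using h0.comp_hasDerivAt (0 : ℝ) hline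
  have hlim := hφ.tendsto_slope_zero_right
  have hlim' : Tendsto (fun t : ℝ => F y - F x - (1 - t) * (τ / 2 * ‖y - x‖ ^ 2)) (𝓝[>] 0)
      (𝓝 (F y - F x - (1 - 0) * (τ / 2 * ‖y - x‖ ^ 2))) :=
    (Continuous.tendsto (by fun_prop) 0).mono_left nhdsWithin_le_nhds
  have hle := le_of_tendsto_of_tendsto hlim hlim' (by
    filter_upwards [Ioo_mem_nhdsGT (show (0 : ℝ) < 1 by norm_num)] with t ht
    have h := hF.2 (Set.mem_univ x) (Set.mem_univ y) (show 0 ≤ 1 - t by linarith [ht.2]) ht.1.le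
      (by ring)
    have hpt : (1 - t) • x + t • y = x + t • (y - x) := by
      rw [sub_smul, smul_sub, one_smul]; abel
    rw [hpt, norm_sub_rev] at h
    simp only [zero_add, zero_smul, add_zero, smul_eq_mul] at h ⊢
    rw [inv_mul_le_iff₀ ht.1]
    linarith)
  linarith

/-- A gradient step of a small length contracts the distance to a critical point. -/
lemma norm_gradient_step_le {F : E → ℝ} {τ : ℝ} (hF : StrongConvexOn Set.univ τ F) {g : E → E}
    (hg : ∀ x, HasGradientAt F (g x) x) {xs : E} (hxs : g xs = 0) {Λ : ℝ}
    (hΛ : ∀ x, ‖g x‖ ≤ Λ * ‖x - xs‖) {α : ℝ} (hα : 0 ≤ α) (hατ : α * τ ≤ 1)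
    (hαΛ : α * Λ ^ 2 ≤ τ / 2) (x : E) :
    ‖x - α • g x - xs‖ ≤ (1 - 3 / 4 * τ * α) * ‖x - xs‖ := by
  have h1 := strongConvexOn_gradient_le hF (hg x) xs
  have h2 := strongConvexOn_gradient_le hF (hg xs) x
  have hmono : τ * ‖x - xs‖ ^ 2 ≤ inner ℝ (g x) (x - xs) := by
    rw [hxs, inner_zero_left] at h2
    rw [← neg_sub, inner_neg_right, norm_neg] at h1
    linarith
  have hsq : ‖g x‖ ^ 2 ≤ Λ ^ 2 * ‖x - xs‖ ^ 2 := by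
    rw [← mul_pow]
    exact pow_le_pow_left₀ (norm_nonneg _) (hΛ x) 2
  refine abs_le_of_sq_le_sq' ?_ (mul_nonneg (by linarith) (norm_nonneg _)) |>.2
  have hexp : ‖x - α • g x - xs‖ ^ 2 =
      ‖x - xs‖ ^ 2 - 2 * α * inner ℝ (g x) (x - xs) + α ^ 2 * ‖g x‖ ^ 2 := by
    rw [sub_right_comm, norm_sub_sq_real, inner_smul_right, real_inner_comm, norm_smul, mul_pow,
      Real.norm_eq_abs, sq_abs]
    ring
  rw [hexp]
  have e1 : α * (τ * ‖x - xs‖ ^ 2) ≤ α * inner ℝ (g x) (x - xs) :=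
    mul_le_mul_of_nonneg_left hmono hα
  have e2 : α ^ 2 * ‖g x‖ ^ 2 ≤ α ^ 2 * (Λ ^ 2 * ‖x - xs‖ ^ 2) :=
    mul_le_mul_of_nonneg_left hsq (sq_nonneg _)
  have e3 : α * ‖x - xs‖ ^ 2 * (α * Λ ^ 2) ≤ α * ‖x - xs‖ ^ 2 * (τ / 2) :=
    mul_le_mul_of_nonneg_left hαΛ (by positivity)
  nlinarith [sq_nonneg (τ * α * ‖x - xs‖)]

/-- A differentiable strongly convex function has exactly one minimizer. -/
lemma exists_unique_minimizer [FiniteDimensional ℝ E] {F : E → ℝ} {τ : ℝ} (hτ : 0 < τ)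
    (hF : StrongConvexOn Set.univ τ F) {g : E → E} (hg : ∀ x, HasGradientAt F (g x) x) :
    ∃ xs, (∀ y, IsMinOn F Set.univ y ↔ y = xs) ∧ g xs = 0 := by
  have hcont : Continuous F := continuous_iff_continuousAt.2 fun x => (hg x).continuousAt
  have hlow : ∀ y, F 0 + ‖y‖ * (τ / 2 * ‖y‖ - ‖g 0‖) ≤ F y := by
    intro y
    have h1 := strongConvexOn_gradient_le hF (hg 0) y
    rw [sub_zero] at h1
    have h2 := (abs_le.1 (abs_real_inner_le_norm (g 0) y)).1
    linarith
  have hcoer : Tendsto F (cocompact E) atTop := by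
    refine tendsto_atTop_mono hlow (tendsto_atTop_add_const_left _ _ ?_)
    have hn : Tendsto (fun y : E => ‖y‖) (cocompact E) atTop := tendsto_norm_cocompact_atTop
    refine hn.atTop_mul_atTop₀ ?_
    exact tendsto_atTop_add_const_right _ _ (hn.const_mul_atTop (by positivity))
  obtain ⟨xs, hxs⟩ := hcont.exists_forall_le hcoer
  have hmin : IsMinOn F Set.univ xs := fun y _ => hxs y
  refine ⟨xs, fun y => ⟨fun hy => ?_, fun hy => hy ▸ hmin⟩, ?_⟩
  · exact (hF.strictConvexOn hτ).eq_of_isMinOn hy hmin (Set.mem_univ _) (Set.mem_univ _)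
  · have := (hmin.isLocalMin Filter.univ_mem).hasFDerivAt_eq_zero (hg xs).hasFDerivAt
    simpa using this

lemma hasGradientAt_sum {ι : Type*} (s : Finset ι) {f : ι → E → ℝ} {g : ι → E} {x : E}
    (h : ∀ i ∈ s, HasGradientAt (f i) (g i) x) :
    HasGradientAt (fun y => ∑ i ∈ s, f i y) (∑ i ∈ s, g i) x := by
  rw [hasGradientAt_iff_hasFDerivAt, map_sum]
  exact HasFDerivAt.fun_sum fun i hi => (h i hi).hasFDerivAt

end StrongConvexity

/-! ### A small-gain estimate for coupled scalar recursions -/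

/-- The small-gain argument. An optimality error `p` that contracts by `1 - 3/4 * μ * γ` per step,
driven by a consensus error `c` and a tracking error `t`, both of which contract by `1 - θ` per
window of `K` steps and are driven by inputs of order `γ` and `c + γ`, respectively, relative to
the whole error `z`. For small `γ`, all of them decay like `(1 - μ * γ / 2) ^ k`, and the bounds of
`c` and `t` are smaller than that of `p` by factors of order `γ`. The constant `B` does not depend
on the horizon `N`. -/
lemma exists_stepsize_linear_rate {K : ℕ} {θ Λ μ : ℝ} (hK : 0 < K) (hθ : 0 < θ) (hθ1 : θ ≤ 1)
    (hΛ : 0 ≤ Λ) (hμ : 0 < μ) :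
    ∃ γ₀ > 0, μ * γ₀ ≤ 1 ∧ ∀ γ, 0 < γ → γ ≤ γ₀ → ∀ (R : ℝ) (k₀ : ℕ), ∃ B : ℝ,
      ∀ (N : ℕ) (p c t z : ℕ → ℝ),
      (∀ k ≤ k₀ + K, p k ≤ R ∧ c k ≤ R ∧ t k ≤ R) →
      (∀ k, k₀ ≤ k → k < N → p (k + 1) ≤ (1 - 3 / 4 * μ * γ) * p k + γ * (Λ * c k + t k)) →
      (∀ k, c (k + K) ≤ (1 - θ) * c k + ∑ s ∈ Finset.range K, 2 * (γ * z (k + s))) →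
      (∀ k, t (k + K) ≤
        (1 - θ) * t k + ∑ s ∈ Finset.range K, 2 * (Λ * (c (k + s) + γ * z (k + s)))) →
      (∀ k, z k ≤ Λ * (p k + c k) + t k) →
      ∀ k ≤ N, p k + c k ≤ B * (1 - μ * γ / 2) ^ k := by
  have hK1 : (1 : ℝ) ≤ K := by exact_mod_cast hK
  -- `c ≤ Ca * γ * p`, `t ≤ Cb * γ * p` and `z ≤ Z * p` are the proportions kept by the recursions
  set Z : ℝ := 2 * Λ + 1 with hZ
  have hZ1 : 1 ≤ Z := by linarith
  set Ca : ℝ := 4 * K * Z / θ with hCa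
  set Cb : ℝ := 4 * K * (Λ * (Ca + Z)) / θ + 1 with hCb
  have hCa0 : 0 < Ca := by positivity
  have hCb0 : 0 < Cb := by positivity
  set Q : ℝ := Ca + Cb + K * μ / θ + 4 * (Λ * Ca + Cb) / μ with hQ
  have hQ0 : 0 < Q := by positivity
  have hKμ : 0 < K * μ / θ := by positivity
  have hΛC : 0 < 4 * (Λ * Ca + Cb) / μ := by positivity
  have hsmall : ∀ X γ : ℝ, 0 < γ → γ ≤ 1 / Q → X ≤ Q → X * γ ≤ 1 := by
    intro X γ hγ hγQ hX
    calc X * γ ≤ Q * γ := by gcongr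
      _ ≤ Q * (1 / Q) := by gcongr
      _ = 1 := by field_simp
  have hμK : ∀ γ : ℝ, 0 < γ → γ ≤ 1 / Q → K * μ * γ ≤ θ := by
    intro γ hγ hγQ
    have := hsmall (K * μ / θ) γ hγ hγQ (by linarith)
    rwa [div_mul_eq_mul_div, div_le_one hθ] at this
  have hμ1 : ∀ γ : ℝ, 0 < γ → γ ≤ 1 / Q → μ * γ ≤ 1 := by
    intro γ hγ hγQ
    have h1 := hμK γ hγ hγQ
    have h2 : 1 * (μ * γ) ≤ K * (μ * γ) := by gcongr
    linarith
  refine ⟨1 / Q, by positivity, hμ1 _ (by positivity) le_rfl, ?_⟩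
  intro γ hγ hγQ R k₀
  have hCaγ := hsmall Ca γ hγ hγQ (by linarith)
  have hCbγ := hsmall Cb γ hγ hγQ (by linarith)
  have hgain : γ * (Λ * Ca + Cb) ≤ μ / 4 := by
    have := hsmall _ γ hγ hγQ (show 4 * (Λ * Ca + Cb) / μ ≤ Q by linarith)
    rw [div_mul_eq_mul_div, div_le_one hμ] at this
    linarith
  have hμγ := hμ1 γ hγ hγQ
  have hμγ0 : 0 < μ * γ := by positivity
  set lam : ℝ := 1 - μ * γ / 2 with hlam
  have hlam0 : 0 < lam := by linarith
  have hlam1 : lam ≤ 1 := by linarith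
  have hlamK : 1 - θ / 2 ≤ lam ^ K := by
    have := one_add_mul_le_pow (show (-2 : ℝ) ≤ -(μ * γ / 2) by linarith) K
    rw [← sub_eq_add_neg 1 (μ * γ / 2)] at this
    have := hμK γ hγ hγQ
    linarith
  have hm0 : 0 < min 1 (min (Ca * γ) (Cb * γ)) := by positivity
  set m : ℝ := min 1 (min (Ca * γ) (Cb * γ)) with hm
  have hm1 : m ≤ 1 := min_le_left _ _
  have hma : m ≤ Ca * γ := (min_le_right _ _).trans (min_le_left _ _)
  have hmb : m ≤ Cb * γ := (min_le_right _ _).trans (min_le_right _ _)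
  -- chosen such that the bounds hold up to time `k₀ + K`, where they are smallest
  set B : ℝ := max R 0 / (m * lam ^ (k₀ + K)) with hB
  have hB0 : 0 ≤ B := by positivity
  refine ⟨2 * B, ?_⟩
  intro N p c t z hinit hp hc ht hz
  have main : ∀ k ≤ N, p k ≤ B * lam ^ k ∧ c k ≤ Ca * γ * (B * lam ^ k) ∧
      t k ≤ Cb * γ * (B * lam ^ k) := by
    intro k
    induction k using Nat.strong_induction_on with
    | _ k ih =>
    intro hkN
    rcases le_or_gt k (k₀ + K) with hk | hk
    · have hR : R ≤ m * (B * lam ^ k) := by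
        have h1 : m * (B * lam ^ (k₀ + K)) = max R 0 := by
          rw [hB]; field_simp
        have h2 : lam ^ (k₀ + K) ≤ lam ^ k := pow_le_pow_of_le_one hlam0.le hlam1 hk
        calc R ≤ max R 0 := le_max_left _ _
          _ = m * (B * lam ^ (k₀ + K)) := h1.symm
          _ ≤ m * (B * lam ^ k) := by gcongr
      have hBk : 0 ≤ B * lam ^ k := by positivity
      obtain ⟨h1, h2, h3⟩ := hinit k hk
      refine ⟨h1.trans (hR.trans ?_), h2.trans (hR.trans ?_), h3.trans (hR.trans ?_)⟩
      · exact mul_le_of_le_one_left hBk hm1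
      · gcongr
      · gcongr
    · have hzle : ∀ s < k, z s ≤ Z * (B * lam ^ s) := by
        intro s hs
        obtain ⟨h1, h2, h3⟩ := ih s hs (by omega)
        have hBs : 0 ≤ B * lam ^ s := by positivity
        have h2' : c s ≤ B * lam ^ s := h2.trans (mul_le_of_le_one_left hBs hCaγ)
        have h3' : t s ≤ B * lam ^ s := h3.trans (mul_le_of_le_one_left hBs hCbγ)
        have : Λ * (p s + c s) ≤ Λ * (2 * (B * lam ^ s)) :=
          mul_le_mul_of_nonneg_left (by linarith) hΛ
        have := hz s
        rw [hZ]; linarith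
      obtain ⟨k', rfl⟩ : ∃ k', k = k' + K := ⟨k - K, by omega⟩
      obtain ⟨-, hck, htk⟩ := ih k' (by omega) (by omega)
      set X : ℝ := B * lam ^ k' with hX
      have hX0 : 0 ≤ X := by positivity
      have hXs : ∀ s, B * lam ^ (k' + s) ≤ X := fun s => by
        rw [hX]
        exact mul_le_mul_of_nonneg_left
          (pow_le_pow_of_le_one hlam0.le hlam1 (Nat.le_add_right _ _)) hB0
      have hXK : (1 - θ / 2) * X ≤ B * lam ^ (k' + K) := by
        calc (1 - θ / 2) * X ≤ lam ^ K * X := mul_le_mul_of_nonneg_right hlamK hX0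
          _ = B * lam ^ (k' + K) := by rw [hX, pow_add]; ring
      have hzX : ∀ s < K, z (k' + s) ≤ Z * X := fun s hs =>
        (hzle _ (by omega)).trans (mul_le_mul_of_nonneg_left (hXs s) (by linarith))
      have hcX : ∀ s < K, c (k' + s) ≤ Ca * γ * X := fun s hs =>
        (ih _ (by omega) (by omega)).2.1.trans
          (mul_le_mul_of_nonneg_left (hXs s) (by positivity))
      refine ⟨?_, ?_, ?_⟩
      · obtain ⟨k, hkk⟩ : ∃ k, k' + K = k + 1 := ⟨k' + K - 1, by omega⟩
        rw [hkk]
        obtain ⟨h1, h2, h3⟩ := ih k (by omega) (by omega)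
        have hY0 : 0 ≤ B * lam ^ k := by positivity
        have e1 : (1 - 3 / 4 * μ * γ) * p k ≤ (1 - 3 / 4 * μ * γ) * (B * lam ^ k) :=
          mul_le_mul_of_nonneg_left h1 (by linarith)
        have e2 : γ * (Λ * c k + t k) ≤
            γ * (Λ * (Ca * γ * (B * lam ^ k)) + Cb * γ * (B * lam ^ k)) := by gcongr
        have e3 : γ * (γ * (Λ * Ca + Cb)) * (B * lam ^ k) ≤ γ * (μ / 4) * (B * lam ^ k) := by
          gcongr
        calc p (k + 1) ≤ (1 - 3 / 4 * μ * γ) * p k + γ * (Λ * c k + t k) :=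
              hp k (by omega) (by omega)
          _ ≤ lam * (B * lam ^ k) := by rw [hlam]; linarith
          _ = B * lam ^ (k + 1) := by ring
      · have hsum : ∑ s ∈ Finset.range K, 2 * (γ * z (k' + s)) ≤ K * (2 * (γ * (Z * X))) := by
          refine (Finset.sum_le_card_nsmul _ _ _ fun s hs => ?_).trans_eq
            (by rw [Finset.card_range, nsmul_eq_mul])
          have := hzX s (Finset.mem_range.1 hs)
          gcongr
        have e1 : (1 - θ) * c k' ≤ (1 - θ) * (Ca * γ * X) :=
          mul_le_mul_of_nonneg_left hck (by linarith)
        have e2 : Ca * γ * ((1 - θ / 2) * X) ≤ Ca * γ * (B * lam ^ (k' + K)) := by gcongr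
        have e3 : Ca * θ = 4 * K * Z := by rw [hCa]; field_simp
        have e4 : K * (2 * (γ * (Z * X))) = Ca * θ * γ * X / 2 := by rw [e3]; ring
        linarith [hc k']
      · have hsum : ∑ s ∈ Finset.range K, 2 * (Λ * (c (k' + s) + γ * z (k' + s))) ≤
            K * (2 * (Λ * (Ca * γ * X + γ * (Z * X)))) := by
          refine (Finset.sum_le_card_nsmul _ _ _ fun s hs => ?_).trans_eq
            (by rw [Finset.card_range, nsmul_eq_mul])
          have h1 := hzX s (Finset.mem_range.1 hs)
          have h2 := hcX s (Finset.mem_range.1 hs)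
          gcongr
        have e1 : (1 - θ) * t k' ≤ (1 - θ) * (Cb * γ * X) :=
          mul_le_mul_of_nonneg_left htk (by linarith)
        have e2 : Cb * γ * ((1 - θ / 2) * X) ≤ Cb * γ * (B * lam ^ (k' + K)) := by gcongr
        have e3 : (Cb - 1) * θ = 4 * K * (Λ * (Ca + Z)) := by rw [hCb]; field_simp; ring
        have e4 : K * (2 * (Λ * (Ca * γ * X + γ * (Z * X)))) = (Cb - 1) * θ * γ * X / 2 := by
          rw [e3]; ring
        have e5 : 0 ≤ θ * γ * X := by positivity
        linarith [ht k']
  intro k hk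
  obtain ⟨h1, h2, -⟩ := main k hk
  have hBk : 0 ≤ B * lam ^ k := by positivity
  have h2' : c k ≤ B * lam ^ k := h2.trans (mul_le_of_le_one_left hBk hCaγ)
  linarith

open scoped Matrix.Module
open Matrix Finset

/-! ### Products of stochastic matrices -/

section Transition
variable {S : Type*} [Fintype S] [DecidableEq S]

/-- The transition matrix over `m` steps from time `k`, i.e. the product
`M (k + m - 1) * ⋯ * M (k + 1) * M k`. -/
def transition (M : ℕ → Matrix S S ℝ) (k : ℕ) : ℕ → Matrix S S ℝ
  | 0 => 1
  | m + 1 => M (k + m) * transition M k m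

lemma transition_add (M : ℕ → Matrix S S ℝ) (k m m' : ℕ) :
    transition M k (m + m') = transition M (k + m) m' * transition M k m := by
  induction m' with
  | zero => simp [transition]
  | succ m' ih => rw [← add_assoc, transition, transition, ih, mul_assoc, add_assoc]

lemma transition_mem {P : Submonoid (Matrix S S ℝ)} {M : ℕ → Matrix S S ℝ}
    (hM : ∀ k, M k ∈ P) (k m : ℕ) : transition M k m ∈ P := by
  induction m with
  | zero => exact P.one_mem
  | succ m ih => exact P.mul_mem (hM _) ih

/-- A lower bound of the transition weight along a path grows by a factor `μ` per step, provided
that each edge of the path has weight at least `μ`. -/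
lemma pow_succ_le_transition {M : ℕ → Matrix S S ℝ} (hM : ∀ k a b, 0 ≤ M k a b) {μ : ℝ}
    (hμ : 0 ≤ μ) {k m : ℕ} {a b c : S} (h : μ ^ m ≤ transition M k m b a)
    (hstep : μ ≤ M (k + m) c b) : μ ^ (m + 1) ≤ transition M k (m + 1) c a := by
  have hnn : ∀ m b a, 0 ≤ transition M k m b a := by
    intro m
    induction m with
    | zero => intro b a; simp only [transition, one_apply]; split_ifs <;> norm_num
    | succ m ih =>
      intro b a
      exact Finset.sum_nonneg fun c _ => mul_nonneg (hM _ _ _) (ih _ _)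
  calc μ ^ (m + 1) = μ * μ ^ m := pow_succ' _ _
    _ ≤ M (k + m) c b * transition M k m b a := by gcongr; exact hM _ _ _
    _ ≤ ∑ b, M (k + m) c b * transition M k m b a :=
      Finset.single_le_sum (f := fun b => M (k + m) c b * transition M k m b a)
        (fun b _ => mul_nonneg (hM _ _ _) (hnn _ _ _)) (Finset.mem_univ b)

end Transition

section Diameter
variable {S : Type*} [Fintype S] {E : Type*} [NormedAddCommGroup E]

/-- The diameter of the finite family `h`. -/
noncomputable def diam (h : S → E) : ℝ := ‖fun p : S × S => h p.1 - h p.2‖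

lemma diam_nonneg (h : S → E) : 0 ≤ diam h := norm_nonneg _

lemma norm_sub_le_diam (h : S → E) (a b : S) : ‖h a - h b‖ ≤ diam h :=
  norm_le_pi_norm (fun p : S × S => h p.1 - h p.2) (a, b)

lemma diam_le {h : S → E} {r : ℝ} (hr : 0 ≤ r) (H : ∀ a b, ‖h a - h b‖ ≤ r) : diam h ≤ r :=
  (pi_norm_le_iff_of_nonneg hr).2 fun p => H p.1 p.2

lemma diam_add_le (h g : S → E) : diam (h + g) ≤ diam h + diam g := by
  refine diam_le (add_nonneg (diam_nonneg _) (diam_nonneg _)) fun a b => ?_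
  calc ‖(h + g) a - (h + g) b‖ = ‖(h a - h b) + (g a - g b)‖ := by
        simp only [Pi.add_apply]; congr 1; abel
    _ ≤ _ := (norm_add_le _ _).trans (add_le_add (norm_sub_le_diam _ _ _) (norm_sub_le_diam _ _ _))

lemma diam_single_le [DecidableEq S] (a : S) (u : E) : diam (Pi.single a u) ≤ 2 * ‖u‖ := by
  have H : ∀ b, ‖(Pi.single a u : S → E) b‖ ≤ ‖u‖ := by
    intro b
    by_cases hb : b = a
    · subst hb; simp
    · simp [hb]
  refine diam_le (by positivity) fun b c => ?_
  linarith [norm_sub_le ((Pi.single a u : S → E) b) ((Pi.single a u : S → E) c), H b, H c]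

end Diameter

section Contraction
variable {S : Type*} [Fintype S] {E : Type*} [NormedAddCommGroup E] [NormedSpace ℝ E]

/-- A convex combination of a family stays within its diameter of each of its members. -/
lemma norm_sum_smul_sub_le_diam {q : S → ℝ} (hq : ∀ a, 0 ≤ q a) (hq1 : ∑ a, q a = 1) (h : S → E)
    (b : S) : ‖∑ a, q a • h a - h b‖ ≤ diam h := by
  have : ∑ a, q a • h a - h b = ∑ a, q a • (h a - h b) := by
    simp [smul_sub, Finset.sum_sub_distrib, ← Finset.sum_smul, hq1]
  rw [this]
  calc ‖∑ a, q a • (h a - h b)‖ ≤ ∑ a, q a * diam h := by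
        refine norm_sum_le_of_le _ fun a _ => ?_
        rw [norm_smul, Real.norm_of_nonneg (hq a)]
        exact mul_le_mul_of_nonneg_left (norm_sub_le_diam _ _ _) (hq a)
    _ = diam h := by rw [← Finset.sum_mul, hq1, one_mul]

/-- Two subprobability vectors of the same mass `s` give combinations at distance at most
`s * diam h`, by coupling them independently. -/
lemma norm_sum_smul_sub_sum_smul_le {q r : S → ℝ} {s : ℝ} (hq : ∀ a, 0 ≤ q a) (hr : ∀ a, 0 ≤ r a)
    (hqs : ∑ a, q a = s) (hrs : ∑ a, r a = s) (h : S → E) :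
    ‖∑ a, q a • h a - ∑ a, r a • h a‖ ≤ s * diam h := by
  have hs : 0 ≤ s := hqs ▸ Finset.sum_nonneg fun a _ => hq a
  rcases hs.eq_or_lt with rfl | hs
  · have hq0 : ∀ a, q a = 0 := fun a =>
      (Finset.sum_eq_zero_iff_of_nonneg fun a _ => hq a).1 hqs a (Finset.mem_univ a)
    have hr0 : ∀ a, r a = 0 := fun a =>
      (Finset.sum_eq_zero_iff_of_nonneg fun a _ => hr a).1 hrs a (Finset.mem_univ a)
    simp [hq0, hr0]
  have key : s • (∑ a, q a • h a - ∑ a, r a • h a) = ∑ a, ∑ b, (q a * r b) • (h a - h b) := by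
    simp only [smul_sub, Finset.sum_sub_distrib]
    congr 1
    · rw [Finset.smul_sum]
      refine Finset.sum_congr rfl fun a _ => ?_
      rw [← Finset.sum_smul, ← Finset.mul_sum, hrs, mul_smul, smul_comm]
    · rw [Finset.sum_comm, Finset.smul_sum]
      refine Finset.sum_congr rfl fun b _ => ?_
      rw [← Finset.sum_smul, ← Finset.sum_mul, hqs, mul_smul]
  have : s * ‖∑ a, q a • h a - ∑ a, r a • h a‖ ≤ s * (s * diam h) := by
    calc s * ‖∑ a, q a • h a - ∑ a, r a • h a‖
        = ‖∑ a, ∑ b, (q a * r b) • (h a - h b)‖ := by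
          rw [← key, norm_smul, Real.norm_of_nonneg hs.le]
      _ ≤ ∑ a, ∑ b, (q a * r b) * diam h := by
          refine norm_sum_le_of_le _ fun a _ => norm_sum_le_of_le _ fun b _ => ?_
          rw [norm_smul, Real.norm_of_nonneg (mul_nonneg (hq a) (hr b))]
          exact mul_le_mul_of_nonneg_left (norm_sub_le_diam _ _ _) (mul_nonneg (hq a) (hr b))
      _ = s * (s * diam h) := by
          simp_rw [← Finset.sum_mul, ← Finset.mul_sum, hrs, ← Finset.sum_mul, hqs]; ring
  exact le_of_mul_le_mul_left this hs

variable [DecidableEq S]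

/-- Doeblin's contraction: a row-stochastic matrix with a column of entries at least `η` shrinks
diameters by the factor `1 - η`. -/
lemma diam_smul_le_of_column {M : Matrix S S ℝ} (hM : M ∈ rowStochastic ℝ S) {η : ℝ}
    {j : S} (hj : ∀ b, η ≤ M b j) (h : S → E) : diam (M • h) ≤ (1 - η) * diam h := by
  rw [mem_rowStochastic_iff_sum] at hM
  have hη : η ≤ 1 := (hj j).trans (hM.2 j ▸ Finset.single_le_sum (f := fun a => M j a)
    (fun a _ => hM.1 j a) (Finset.mem_univ j))
  refine diam_le (mul_nonneg (by linarith) (diam_nonneg _)) fun b c => ?_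
  have hsplit : ∀ b, (M • h) b = ∑ a, (M b a - if a = j then η else 0) • h a + η • h j := by
    intro b
    simp [sub_smul, Finset.sum_sub_distrib, ite_smul]
  rw [hsplit, hsplit, add_sub_add_right_eq_sub]
  have hnn : ∀ b a, 0 ≤ M b a - if a = j then η else 0 := by
    intro b a
    split_ifs with ha
    · subst ha; linarith [hj b]
    · simpa using hM.1 b a
  refine norm_sum_smul_sub_sum_smul_le (hnn b) (hnn c) ?_ ?_ h <;>
    simp [Finset.sum_sub_distrib, hM.2]

lemma diam_smul_le {M : Matrix S S ℝ} (hM : M ∈ rowStochastic ℝ S) [Nonempty S] (h : S → E) :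
    diam (M • h) ≤ diam h := by
  obtain ⟨j⟩ := ‹Nonempty S›
  simpa using diam_smul_le_of_column hM (η := 0) (j := j)
    (fun b => (mem_rowStochastic.1 hM).1 b j) h

lemma sum_smul_of_mem_colStochastic {M : Matrix S S ℝ} (hM : M ∈ colStochastic ℝ S) (y : S → E) :
    ∑ b, (M • y) b = ∑ a, y a := by
  simp only [Matrix.Module.smul_apply]
  rw [Finset.sum_comm]
  simp [← Finset.sum_smul, sum_col_of_mem_colStochastic hM]

/-- The transposed form of Doeblin's contraction: a column-stochastic matrix with a row of entries
at least `η` shrinks the `ℓ¹` norm of families with sum zero by the factor `1 - η`. -/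
lemma sum_norm_smul_le_of_row {M : Matrix S S ℝ} (hM : M ∈ colStochastic ℝ S) {η : ℝ}
    {j : S} (hj : ∀ a, η ≤ M j a) {y : S → E} (hy : ∑ a, y a = 0) :
    ∑ b, ‖(M • y) b‖ ≤ (1 - η) * ∑ a, ‖y a‖ := by
  rw [mem_colStochastic_iff_sum] at hM
  have hnn : ∀ b a, 0 ≤ M b a - if b = j then η else 0 := by
    intro b a
    split_ifs with ha
    · subst ha; linarith [hj a]
    · simpa using hM.1 b a
  have hsplit : ∀ b, (M • y) b = ∑ a, (M b a - if b = j then η else 0) • y a := by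
    intro b
    simp [sub_smul, Finset.sum_sub_distrib, ← Finset.smul_sum, hy]
  calc ∑ b, ‖(M • y) b‖ ≤ ∑ b, ∑ a, (M b a - if b = j then η else 0) * ‖y a‖ := by
        refine Finset.sum_le_sum fun b _ => ?_
        rw [hsplit]
        refine norm_sum_le_of_le _ fun a _ => ?_
        rw [norm_smul, Real.norm_of_nonneg (hnn b a)]
    _ = (1 - η) * ∑ a, ‖y a‖ := by
        rw [Finset.sum_comm, Finset.mul_sum]
        refine Finset.sum_congr rfl fun a _ => ?_
        rw [← Finset.sum_mul, Finset.sum_sub_distrib, hM.2]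
        simp

/-- A perturbed linear recursion whose transition maps shrink a subadditive gauge on an invariant
subgroup over windows of length `K`: after a window, the gauge is at most the shrunk gauge plus the
gauges of the inputs met in the window. -/
lemma gauge_window_le {M : ℕ → Matrix S S ℝ} {gauge : (S → E) → ℝ} (P : AddSubgroup (S → E))
    (hzero : gauge 0 = 0) (hadd : ∀ g h, gauge (g + h) ≤ gauge g + gauge h)
    (hP : ∀ k, ∀ h ∈ P, M k • h ∈ P) (hmono : ∀ k, ∀ h ∈ P, gauge (M k • h) ≤ gauge h)
    {θ : ℝ} {K : ℕ} (hK : ∀ k, ∀ h ∈ P, gauge (transition M k K • h) ≤ θ * gauge h)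
    {h u : ℕ → S → E} (hh : ∀ k, h k ∈ P) (hu : ∀ k, u k ∈ P)
    (hrec : ∀ k, h (k + 1) = M k • (h k + u k)) (k : ℕ) :
    gauge (h (k + K)) ≤ θ * gauge (h k) + ∑ s ∈ Finset.range K, gauge (u (k + s)) := by
  have key : ∀ m, ∃ w ∈ P, h (k + m) = transition M k m • h k + w ∧
      gauge w ≤ ∑ s ∈ Finset.range m, gauge (u (k + s)) := by
    intro m
    induction m with
    | zero => exact ⟨0, P.zero_mem, by simp [transition], by simp [hzero]⟩
    | succ m ih =>
      obtain ⟨w, hw, hhw, hgw⟩ := ih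
      refine ⟨M (k + m) • (w + u (k + m)), hP _ _ (P.add_mem hw (hu _)), ?_, ?_⟩
      · rw [← add_assoc, hrec, hhw, transition, mul_smul, ← smul_add, add_assoc]
      · rw [Finset.sum_range_succ]
        linarith [hmono (k + m) _ (P.add_mem hw (hu (k + m))), hadd w (u (k + m))]
  obtain ⟨w, -, hhw, hgw⟩ := key K
  rw [hhw]
  linarith [hadd (transition M k K • h k) w, hK k _ (hh k)]

/-- For row-stochastic matrices and a finite horizon `N`, there are weights `ψ k` such that
`∑ a, ψ k a • h k a` is invariant under `h (k + 1) = M k • h k` up to time `N`. A finite horizon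
spares the construction of the limit `N → ∞`, the absolute probability sequence. -/
lemma exists_backward_weights [Nonempty S] {M : ℕ → Matrix S S ℝ}
    (hM : ∀ k, M k ∈ rowStochastic ℝ S) (N : ℕ) :
    ∃ ψ : ℕ → S → ℝ, (∀ k a, 0 ≤ ψ k a) ∧ (∀ k, ∑ a, ψ k a = 1) ∧
      (∀ k < N, ∀ a, ψ k a = ∑ b, ψ (k + 1) b * M k b a) ∧
      ∀ (k K : ℕ) (j : S) (η : ℝ), k + K ≤ N → (∀ b, η ≤ transition M k K b j) → η ≤ ψ k j := by
  obtain ⟨a₀⟩ := ‹Nonempty S›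
  have hmem := fun k m => mem_rowStochastic_iff_sum.1 (transition_mem hM k m)
  refine ⟨fun k a => transition M k (N - k) a₀ a, fun k a => (hmem _ _).1 _ _,
    fun k => (hmem _ _).2 _, ?_, ?_⟩
  · intro k hk a
    obtain ⟨m, rfl⟩ : ∃ m, N = k + 1 + m := ⟨N - (k + 1), by omega⟩
    simp only [show k + 1 + m - k = 1 + m by omega, show k + 1 + m - (k + 1) = m by omega,
      transition_add]
    simp [transition, mul_apply]
  · intro k K j η hk hη
    obtain ⟨m, rfl⟩ : ∃ m, N = k + K + m := ⟨N - (k + K), by omega⟩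
    simp only [show k + K + m - k = K + m by omega, transition_add, mul_apply]
    calc η = ∑ b, transition M (k + K) m a₀ b * η := by
          rw [← Finset.sum_mul, (hmem _ _).2, one_mul]
      _ ≤ _ := Finset.sum_le_sum fun b _ => mul_le_mul_of_nonneg_left (hη b) ((hmem _ _).1 _ _)

/-- Column-stochastic matrices have a trajectory `ξ` of probability vectors, and a row of entries at
least `η` of a transition matrix bounds an entry of `ξ` from below. -/
lemma exists_forward_weights [Nonempty S] {M : ℕ → Matrix S S ℝ}
    (hM : ∀ k, M k ∈ colStochastic ℝ S) :
    ∃ ξ : ℕ → S → ℝ, (∀ k a, 0 ≤ ξ k a) ∧ (∀ k, ∑ a, ξ k a = 1) ∧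
      (∀ k b, ξ (k + 1) b = ∑ a, M k b a * ξ k a) ∧
      ∀ (k K : ℕ) (j : S) (η : ℝ), (∀ a, η ≤ transition M k K j a) → η ≤ ξ (k + K) j := by
  obtain ⟨a₀⟩ := ‹Nonempty S›
  have hmem := fun k m => mem_colStochastic_iff_sum.1 (transition_mem hM k m)
  refine ⟨fun k a => transition M 0 k a a₀, fun k a => (hmem _ _).1 _ _,
    fun k => (hmem _ _).2 _, ?_, ?_⟩
  · intro k b
    simp [transition, mul_apply]
  · intro k K j η hη
    simp only [transition_add, mul_apply, zero_add]
    calc η = ∑ b, η * transition M 0 k b a₀ := by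
          rw [← Finset.mul_sum, (hmem _ _).2, mul_one]
      _ ≤ _ := Finset.sum_le_sum fun b _ => mul_le_mul_of_nonneg_right (hη b) ((hmem _ _).1 _ _)

end Contraction

/-! ### Spreading along a strongly connected digraph -/

section Spreading
variable {V : Type*} [Fintype V]

/-- If a property of agents persists in time and passes along each edge within `h` time units, then
it reaches all agents of a strongly connected digraph after `card V - 1` hops. -/
lemma forall_of_hop {G : Digraph V} (hconn : StronglyConnected G) {Q : ℕ → V → Prop} {h : ℕ}
    (hmono : ∀ m j, Q m j → ∀ m' ≥ m, Q m' j) (hhop : ∀ m j l, G.Adj j l → Q m j → Q (m + h) l)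
    {i : V} (h0 : Q 0 i) (l : V) : Q ((Fintype.card V - 1) * h) l := by
  classical
  set R : ℕ → Finset V := fun n => univ.filter (Q (n * h)) with hR
  have hsub : ∀ n, R n ⊆ R (n + 1) := fun n j hj => by
    simp only [hR, mem_filter, mem_univ, true_and] at hj ⊢
    exact hmono _ _ hj _ (Nat.mul_le_mul_right _ (Nat.le_succ n))
  have hi : ∀ n, i ∈ R n := by
    intro n
    induction n with
    | zero => simpa [hR] using h0
    | succ n ih => exact hsub n ih
  have hgrow : ∀ n, R n ≠ univ → (R n).card < (R (n + 1)).card := by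
    intro n hn
    refine card_lt_card ((ssubset_iff_of_subset (hsub n)).2 ?_)
    by_contra! hcon
    refine hn (eq_univ_of_forall fun l => ?_)
    induction hconn i l with
    | refl => exact hi n
    | @tail j l _ hjl ih =>
      refine hcon l ?_
      simp only [hR, mem_filter, mem_univ, true_and] at ih ⊢
      rw [add_mul, one_mul]
      exact hhop _ _ _ hjl ih
  have hcard : ∀ n, n + 1 ≤ (R n).card ∨ R n = univ := by
    intro n
    induction n with
    | zero => exact Or.inl (card_pos.2 ⟨i, hi 0⟩)
    | succ n ih =>
      by_cases hn : R n = univ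
      · exact Or.inr (univ_subset_iff.1 (hn ▸ hsub n))
      · have := hgrow n hn
        rcases ih with ih | ih
        · exact Or.inl (by omega)
        · exact absurd ih hn
  have hall : R (Fintype.card V - 1) = univ := by
    rcases hcard (Fintype.card V - 1) with h1 | h1
    · refine eq_univ_of_card _ (le_antisymm (card_le_univ _) ?_)
      have : 0 < Fintype.card V := Fintype.card_pos_iff.2 ⟨i⟩
      omega
    · exact h1
  have hl := mem_univ l
  rw [← hall] at hl
  simpa [hR] using hl

lemma K1_eq [Nonempty V] (T D : ℕ) :
    K1 (Fintype.card V) T D = (Fintype.card V - 1) * (2 * T + D) + (T + D) := by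
  obtain ⟨m, hm⟩ : ∃ m, Fintype.card V = m + 1 := ⟨Fintype.card V - 1, by
    have : 0 < Fintype.card V := Fintype.card_pos
    omega⟩
  rw [hm, K1, show 2 * (m + 1) - 1 = 2 * m + 1 by omega, Nat.add_sub_cancel]
  ring

end Spreading

section Weights
variable {V : Type*} {G : Digraph V} {mbar : ℝ}

lemma Compliant.nonneg {M : Matrix V V ℝ} (h : Compliant G mbar M) (hm : 0 < mbar) (i j : V) :
    0 ≤ M i j := by
  by_cases hij : i = j
  · exact hij ▸ hm.le.trans (h.diag i)
  · by_cases hadj : G.Adj j i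
    · exact hm.le.trans (h.edge i j hadj)
    · exact (h.zero i j hij hadj).ge

lemma Compliant.le_one [Fintype V] {M : Matrix V V ℝ} (h : Compliant G mbar M) (hm : 0 < mbar)
    (hrow : ∀ i, ∑ j, M i j = 1) [Nonempty V] : mbar ≤ 1 := by
  obtain ⟨i⟩ := ‹Nonempty V›
  exact (h.diag i).trans (hrow i ▸ single_le_sum (f := fun j => M i j)
    (fun j _ => h.nonneg hm i j) (mem_univ i))

end Weights

/-! ### Delayed averaging as an augmented row-stochastic recursion -/

section Consensus
variable {V : Type*} [Fintype V] [DecidableEq V] {D : ℕ}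

/-- The node from which the active agent `i` reads the data of agent `j`, when the data of the
other agents is delayed by `δ`. The node `inl j` holds the iterate of agent `j`, and the node
`inr (j, d)` its descent variable `d` iterations ago. -/
def readNode (i : V) (δ : V → Fin (D + 1)) (j : V) : V ⊕ V × Fin (D + 1) :=
  if j = i then Sum.inl i else Sum.inr (j, δ j)

/-- The node whose value is copied to the given node when agent `i` is active. The iterate of the
agent `i` itself is not copied but averaged, so the value at `inl i` is irrelevant. -/
def prevNode (i : V) : V ⊕ V × Fin (D + 1) → V ⊕ V × Fin (D + 1)
  | Sum.inl l => Sum.inl l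
  | Sum.inr (l, d) =>
    Fin.cases (if l = i then Sum.inl i else Sum.inr (l, 0)) (fun d => Sum.inr (l, d.castSucc)) d

/-- One step of delayed averaging as a matrix on the iterates and the descent variables of the
last `D + 1` iterations: the active agent `i` averages, and all other nodes copy. -/
def consensusMatrix (W : Matrix V V ℝ) (i : V) (δ : V → Fin (D + 1)) :
    Matrix (V ⊕ V × Fin (D + 1)) (V ⊕ V × Fin (D + 1)) ℝ :=
  Matrix.of fun b a =>
    if b = Sum.inl i then ∑ j, if readNode i δ j = a then W i j else 0
    else if prevNode i b = a then 1 else 0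

lemma consensusMatrix_smul_apply {E : Type*} [AddCommGroup E] [Module ℝ E] (W : Matrix V V ℝ)
    (i : V) (δ : V → Fin (D + 1)) (h : V ⊕ V × Fin (D + 1) → E) (b : V ⊕ V × Fin (D + 1)) :
    (consensusMatrix W i δ • h) b =
      if b = Sum.inl i then ∑ j, W i j • h (readNode i δ j) else h (prevNode i b) := by
  rw [Matrix.Module.smul_apply]
  split_ifs with hb
  · simp only [consensusMatrix, of_apply, hb, if_true, sum_smul, ite_smul, zero_smul]
    rw [sum_comm]
    simp
  · simp [consensusMatrix, hb]

lemma consensusMatrix_mem {W : Matrix V V ℝ} (hW : ∀ i j, 0 ≤ W i j) (hW1 : ∀ i, ∑ j, W i j = 1)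
    (i : V) (δ : V → Fin (D + 1)) : consensusMatrix W i δ ∈ rowStochastic ℝ _ := by
  rw [mem_rowStochastic_iff_sum]
  constructor
  · intro b a
    simp only [consensusMatrix, of_apply]
    split_ifs
    · exact sum_nonneg fun j _ => by split_ifs <;> simp [hW]
    all_goals norm_num
  · intro b
    simp only [consensusMatrix, of_apply]
    split_ifs
    · rw [sum_comm]
      simp [hW1]
    · simp

lemma le_consensusMatrix_readNode {W : Matrix V V ℝ} (hW : ∀ i j, 0 ≤ W i j) (i j : V)
    (δ : V → Fin (D + 1)) : W i j ≤ consensusMatrix W i δ (Sum.inl i) (readNode i δ j) := by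
  simp only [consensusMatrix, of_apply, if_true]
  refine le_trans (by simp) (single_le_sum
    (f := fun j' => if readNode i δ j' = readNode i δ j then W i j' else 0)
    (fun j' _ => by split_ifs <;> simp [hW]) (mem_univ j))

lemma consensusMatrix_prevNode {W : Matrix V V ℝ} {i : V} {b : V ⊕ V × Fin (D + 1)}
    (δ : V → Fin (D + 1)) (hb : b ≠ Sum.inl i) : consensusMatrix W i δ b (prevNode i b) = 1 := by
  simp [consensusMatrix, hb]

/-- Over a window of `K₁` iterations, the iterate of each agent reaches all nodes with a weight of
at least `η`: a hop to a neighbor takes at most `T` iterations until the agent updates its descent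
variable, `D` until all delayed copies of it are updated, and `T` until the neighbor reads. -/
lemma eta_le_transition_consensusMatrix [Nonempty V] {G : Digraph V} (hloop : NoSelfLoops G)
    (hconn : StronglyConnected G) {mbar : ℝ} (hm : 0 < mbar) {W : Matrix V V ℝ}
    (hW : Compliant G mbar W) (hW1 : ∀ i, ∑ j, W i j = 1) {T : ℕ} {act : ℕ → V}
    (hact : ∀ k i, ∃ t, k ≤ t ∧ t < k + T ∧ act t = i) (δ : ℕ → V → Fin (D + 1)) (k : ℕ) (i : V)
    (b : V ⊕ V × Fin (D + 1)) :
    eta mbar (Fintype.card V) T D ≤ transition (fun k => consensusMatrix W (act k) (δ k)) k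
      (K1 (Fintype.card V) T D) b (Sum.inl i) := by
  have hnn := hW.nonneg hm
  have hm1 := hW.le_one hm hW1
  set M := fun k => consensusMatrix W (act k) (δ k) with hM
  set P : ℕ → V ⊕ V × Fin (D + 1) → Prop :=
    fun m b => mbar ^ m ≤ transition M k m b (Sum.inl i) with hP
  have hstep : ∀ m b c, P m b → mbar ≤ M (k + m) c b → P (m + 1) c := fun m b c h1 h2 =>
    pow_succ_le_transition (fun k => (mem_rowStochastic.1 (consensusMatrix_mem hnn hW1 _ _)).1)
      hm.le h1 h2
  have hcopy : ∀ m b c, P m b → c ≠ Sum.inl (act (k + m)) → prevNode (act (k + m)) c = b →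
      P (m + 1) c := by
    rintro m b c h1 h2 rfl
    exact hstep _ _ _ h1 (hm1.trans_eq (consensusMatrix_prevNode _ h2).symm)
  have hread : ∀ m j, P m (readNode (act (k + m)) (δ (k + m)) j) → mbar ≤ W (act (k + m)) j →
      P (m + 1) (Sum.inl (act (k + m))) := fun m j h1 h2 =>
    hstep _ _ _ h1 (h2.trans (le_consensusMatrix_readNode hnn _ _ _))
  have hstay : ∀ m j, P m (Sum.inl j) → ∀ m' ≥ m, P m' (Sum.inl j) := by
    intro m j hmj m' hm'
    induction m', hm' using Nat.le_induction with
    | base => exact hmj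
    | succ m' _ ih =>
      by_cases hj : j = act (k + m')
      · rw [hj] at ih ⊢
        refine hread m' (act (k + m')) ?_ (hW.diag _)
        simpa [readNode] using ih
      · exact hcopy _ _ _ ih (by simpa using hj) rfl
  have hwrite : ∀ m j, P m (Sum.inl j) → ∀ m' ≥ m + T, P m' (Sum.inr (j, 0)) := by
    intro m j hmj
    obtain ⟨t, ht1, ht2, ht3⟩ := hact (k + m) j
    have haux : ∀ m' ≥ t - k + 1, P m' (Sum.inr (j, 0)) := by
      have hself : ∀ m' ≥ t - k, j = act (k + m') → P (m' + 1) (Sum.inr (j, 0)) := by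
        intro m' hm' hj
        exact hcopy _ _ _ (hstay m j hmj m' (by omega)) (by simp) (by simp [prevNode, ← hj])
      intro m' hm'
      induction m', hm' using Nat.le_induction with
      | base => exact hself _ le_rfl (by rw [← ht3]; congr 1; omega)
      | succ m' hm' ih =>
        by_cases hj : j = act (k + m')
        · exact hself m' (by omega) hj
        · exact hcopy _ _ _ ih (by simp) (by simp [prevNode, hj])
    exact fun m' hm' => haux m' (by omega)
  have hshift : ∀ m j, P m (Sum.inl j) → ∀ m' ≥ m + (T + D), ∀ d, P m' (Sum.inr (j, d)) := by
    intro m j hmj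
    have haux : ∀ d : Fin (D + 1), ∀ m' ≥ m + T + d, P m' (Sum.inr (j, d)) := by
      intro d
      induction d using Fin.induction with
      | zero => simpa using hwrite m j hmj
      | succ d ih =>
        intro m' hm'
        rw [Fin.val_succ] at hm'
        obtain ⟨m', rfl⟩ : ∃ n, m' = n + 1 := ⟨m' - 1, by omega⟩
        refine hcopy _ _ _ (ih m' ?_) (by simp) (by simp [prevNode])
        rw [Fin.val_castSucc]; omega
    exact fun m' hm' d => haux d m' (by have := d.is_lt; omega)
  have hhop : ∀ m j l, G.Adj j l → P m (Sum.inl j) → P (m + (2 * T + D)) (Sum.inl l) := by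
    intro m j l hjl hmj
    obtain ⟨t, ht1, ht2, rfl⟩ := hact (k + (m + (T + D))) l
    obtain ⟨s, rfl⟩ : ∃ s, t = k + s := ⟨t - k, by omega⟩
    have hne : j ≠ act (k + s) := fun h => hloop _ (h ▸ hjl)
    refine hstay (s + 1) _ (hread s j ?_ (hW.edge _ _ hjl)) _ (by omega)
    rw [readNode, if_neg hne]
    exact hshift m j hmj s (by omega) _
  have hall := fun j => forall_of_hop hconn (Q := fun m j => P m (Sum.inl j)) hstay hhop
    (i := i) (by simp [hP, transition]) j
  have hfin : P (K1 (Fintype.card V) T D) b := by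
    rw [K1_eq]
    rcases b with j | ⟨j, d⟩
    · exact hstay _ _ (hall j) _ (by omega)
    · exact hshift _ _ (hall j) _ le_rfl d
  exact hfin

end Consensus

/-! ### Delayed push-sum as an augmented column-stochastic recursion -/

section Tracking
variable {V : Type*} [Fintype V] [DecidableEq V] {D : ℕ}

/-- The node to which the active agent `i` sends the share of agent `l`. The node `inl l` holds the
mass of agent `l`, and the node `inr ((j, l), d)` the mass on its way from `j` to `l` which was
sent `d` iterations ago, or at least `D` iterations ago if `d = D`. -/
def pushNode (i l : V) : V ⊕ (V × V) × Fin (D + 1) :=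
  if l = i then Sum.inl i else Sum.inr ((i, l), 0)

/-- The nodes whose mass is collected by the active agent `i`, when it reads the data of agent `j`
with delay `δ j`: its own node and all sufficiently old mass addressed to it. -/
def Gathered (i : V) (δ : V → Fin (D + 1)) : V ⊕ (V × V) × Fin (D + 1) → Prop
  | Sum.inl l => l = i
  | Sum.inr ((j, l), d) => l = i ∧ δ j ≤ d

instance (i : V) (δ : V → Fin (D + 1)) : DecidablePred (Gathered i δ)
  | Sum.inl l => inferInstanceAs (Decidable (l = i))
  | Sum.inr ((j, l), d) => inferInstanceAs (Decidable (l = i ∧ δ j ≤ d))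

/-- The node to which mass that is not collected moves in one iteration. -/
def agedNode : V ⊕ (V × V) × Fin (D + 1) → V ⊕ (V × V) × Fin (D + 1)
  | Sum.inl l => Sum.inl l
  | Sum.inr (e, d) => Sum.inr (e, ⟨min (d + 1) D, by omega⟩)

/-- One step of the push-sum protocol with delays as a matrix on the masses of the agents and the
masses in transit: the active agent `i` collects and distributes, the other masses age. -/
def trackingMatrix (A : Matrix V V ℝ) (i : V) (δ : V → Fin (D + 1)) :
    Matrix (V ⊕ (V × V) × Fin (D + 1)) (V ⊕ (V × V) × Fin (D + 1)) ℝ :=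
  Matrix.of fun b a =>
    if Gathered i δ a then ∑ l, if pushNode i l = b then A l i else 0
    else if agedNode a = b then 1 else 0

lemma trackingMatrix_smul_apply {E : Type*} [AddCommGroup E] [Module ℝ E] (A : Matrix V V ℝ)
    (i : V) (δ : V → Fin (D + 1)) (y : V ⊕ (V × V) × Fin (D + 1) → E)
    (b : V ⊕ (V × V) × Fin (D + 1)) :
    (trackingMatrix A i δ • y) b =
      (∑ l, if pushNode i l = b then A l i else 0) • (∑ a, if Gathered i δ a then y a else 0) +
      ∑ a, if Gathered i δ a then 0 else if agedNode a = b then y a else 0 := by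
  rw [Matrix.Module.smul_apply, smul_sum, ← sum_add_distrib]
  refine sum_congr rfl fun a _ => ?_
  simp only [trackingMatrix, of_apply]
  split_ifs <;> simp

lemma trackingMatrix_mem {A : Matrix V V ℝ} (hA : ∀ i j, 0 ≤ A i j) (hA1 : ∀ j, ∑ i, A i j = 1)
    (i : V) (δ : V → Fin (D + 1)) : trackingMatrix A i δ ∈ colStochastic ℝ _ := by
  rw [mem_colStochastic_iff_sum]
  constructor
  · intro b a
    simp only [trackingMatrix, of_apply]
    split_ifs
    · exact sum_nonneg fun j _ => by split_ifs <;> simp [hA]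
    all_goals norm_num
  · intro a
    simp only [trackingMatrix, of_apply]
    split_ifs
    · rw [sum_comm]
      simp [hA1]
    · simp

lemma le_trackingMatrix_pushNode {A : Matrix V V ℝ} (hA : ∀ i j, 0 ≤ A i j) (i l : V)
    {δ : V → Fin (D + 1)} {a : V ⊕ (V × V) × Fin (D + 1)} (ha : Gathered i δ a) :
    A l i ≤ trackingMatrix A i δ (pushNode i l) a := by
  simp only [trackingMatrix, of_apply, if_pos ha]
  refine le_trans (by simp) (single_le_sum
    (f := fun l' => if (pushNode i l' : V ⊕ (V × V) × Fin (D + 1)) = pushNode i l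
      then A l' i else 0)
    (fun j' _ => by split_ifs <;> simp [hA]) (mem_univ l))

lemma trackingMatrix_agedNode {A : Matrix V V ℝ} {i : V} {δ : V → Fin (D + 1)}
    {a : V ⊕ (V × V) × Fin (D + 1)} (ha : ¬ Gathered i δ a) :
    trackingMatrix A i δ (agedNode a) a = 1 := by
  simp [trackingMatrix, ha]

/-- Over a window of `K₁` iterations, a share of at least `η` of the mass at each node reaches each
agent. -/
lemma eta_le_transition_trackingMatrix [Nonempty V] {G : Digraph V} (hloop : NoSelfLoops G)
    (hconn : StronglyConnected G) {mbar : ℝ} (hm : 0 < mbar) (hm1 : mbar ≤ 1) {A : Matrix V V ℝ}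
    (hA : Compliant G mbar A) (hA1 : ∀ j, ∑ i, A i j = 1) {T : ℕ} {act : ℕ → V}
    (hact : ∀ k i, ∃ t, k ≤ t ∧ t < k + T ∧ act t = i) (δ : ℕ → V → Fin (D + 1)) (k : ℕ) (l : V)
    (a : V ⊕ (V × V) × Fin (D + 1)) :
    eta mbar (Fintype.card V) T D ≤ transition (fun k => trackingMatrix A (act k) (δ k)) k
      (K1 (Fintype.card V) T D) (Sum.inl l) a := by
  have hnn := hA.nonneg hm
  set M := fun k => trackingMatrix A (act k) (δ k) with hM
  set P : ℕ → V ⊕ (V × V) × Fin (D + 1) → Prop :=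
    fun m b => mbar ^ m ≤ transition M k m b a with hP
  have hstep : ∀ m b c, P m b → mbar ≤ M (k + m) c b → P (m + 1) c := fun m b c h1 h2 =>
    pow_succ_le_transition (fun k => (mem_colStochastic.1 (trackingMatrix_mem hnn hA1 _ _)).1)
      hm.le h1 h2
  have hage : ∀ m b, P m b → ¬ Gathered (act (k + m)) (δ (k + m)) b → P (m + 1) (agedNode b) :=
    fun m b h1 h2 => hstep _ _ _ h1 (hm1.trans_eq (trackingMatrix_agedNode h2).symm)
  have hpush : ∀ m b l, P m b → Gathered (act (k + m)) (δ (k + m)) b →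
      mbar ≤ A l (act (k + m)) → P (m + 1) (pushNode (act (k + m)) l) :=
    fun m b l h1 h2 h3 => hstep _ _ _ h1 (h3.trans (le_trackingMatrix_pushNode hnn _ _ h2))
  have hkeep : ∀ m b, P m b → Gathered (act (k + m)) (δ (k + m)) b →
      P (m + 1) (Sum.inl (act (k + m))) := by
    intro m b h1 h2
    simpa [pushNode] using hpush m b _ h1 h2 (hA.diag (act (k + m)))
  have hstay : ∀ m j, P m (Sum.inl j) → ∀ m' ≥ m, P m' (Sum.inl j) := by
    intro m j hmj m' hm'
    induction m', hm' using Nat.le_induction with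
    | base => exact hmj
    | succ m' _ ih =>
      by_cases hj : j = act (k + m')
      · rw [hj] at ih ⊢
        exact hkeep _ _ ih rfl
      · exact hage _ _ ih hj
  have hdeliver : ∀ m j l d, P m (Sum.inr ((j, l), d)) → P (m + (T + D)) (Sum.inl l) := by
    intro m j l d hmd
    -- the mass ages until it is collected, at the latest when `l` is active after `D` iterations
    have haux : ∀ n, (∃ s ≤ m + n, P s (Sum.inl l)) ∨
        P (m + n) (Sum.inr ((j, l), ⟨min (d + n) D, by omega⟩)) := by
      intro n
      induction n with
      | zero =>
        right
        have : (⟨min (d + 0) D, by omega⟩ : Fin (D + 1)) = d := by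
          ext; have := d.is_lt; simp; omega
        rw [this]
        exact hmd
      | succ n ih =>
        rcases ih with ⟨s, hs, hPs⟩ | hPn
        · exact Or.inl ⟨s, by omega, hPs⟩
        · by_cases hg : Gathered (act (k + (m + n))) (δ (k + (m + n)))
              (Sum.inr ((j, l), (⟨min (d + n) D, by omega⟩ : Fin (D + 1))))
          · exact Or.inl ⟨m + n + 1, by omega, hg.1 ▸ hkeep _ _ hPn hg⟩
          · right
            have := hage _ _ hPn hg
            have hidx : (⟨min (min (d + n) D + 1) D, by omega⟩ : Fin (D + 1)) =
                ⟨min (d + (n + 1)) D, by omega⟩ := by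
              ext; simp; omega
            simp only [agedNode, hidx] at this
            exact this
    obtain ⟨t, ht1, ht2, rfl⟩ := hact (k + (m + D)) l
    obtain ⟨n, rfl⟩ : ∃ n, t = k + (m + n) := ⟨t - k - m, by omega⟩
    rcases haux n with ⟨s, hs, hPs⟩ | hPn
    · exact hstay s _ hPs _ (by omega)
    · refine hstay (m + n + 1) _ (hkeep _ _ hPn ⟨rfl, ?_⟩) _ (by omega)
      rw [Fin.le_def]
      have := (δ (k + (m + n)) j).is_lt
      simp only
      omega
  have hhop : ∀ m j l, G.Adj j l → P m (Sum.inl j) → P (m + (2 * T + D)) (Sum.inl l) := by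
    intro m j l hjl hmj
    obtain ⟨t, ht1, ht2, rfl⟩ := hact (k + m) j
    obtain ⟨s, rfl⟩ : ∃ s, t = k + s := ⟨t - k, by omega⟩
    have hne : l ≠ act (k + s) := fun h => hloop _ (h ▸ hjl)
    have hsent := hpush s _ l (hstay m _ hmj s (by omega)) rfl (hA.edge _ _ hjl)
    rw [pushNode, if_neg hne] at hsent
    exact hstay _ _ (hdeliver _ _ _ _ hsent) _ (by omega)
  have hstart : ∃ i, P (T + D) (Sum.inl i) := by
    have h0 : P 0 a := by simp [hP, transition]
    rcases a with i | ⟨⟨j, i⟩, d⟩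
    · exact ⟨i, hstay 0 i h0 _ (Nat.zero_le _)⟩
    · exact ⟨i, by simpa using hdeliver 0 j i d h0⟩
  obtain ⟨i, hi⟩ := hstart
  have hfin := forall_of_hop hconn (Q := fun m j => P (m + (T + D)) (Sum.inl j)) (h := 2 * T + D)
    (fun m j h m' hm' => hstay _ _ h _ (by omega))
    (fun m j l hjl h => by
      have := hhop _ _ _ hjl h
      rwa [show m + (T + D) + (2 * T + D) = m + (2 * T + D) + (T + D) by omega] at this)
    (i := i) (by simpa using hi) l
  rw [← K1_eq] at hfin
  exact hfin

end Tracking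

/-! ### Masses in transit -/

section Telescoping
variable {E : Type*} [AddCommGroup E]

lemma sum_fin_ite_le_telescope (R : ℕ → E) {D : ℕ} (m : Fin (D + 1)) :
    ∑ d : Fin (D + 1), (if m ≤ d then R d - R (d + 1) else 0) = R m - R (D + 1) := by
  have key : ∀ n, ∑ d ∈ range n, (if (m : ℕ) ≤ d then R d - R (d + 1) else 0) =
      if (m : ℕ) ≤ n then R m - R n else 0 := by
    intro n
    induction n with
    | zero =>
      rcases Nat.eq_zero_or_pos (m : ℕ) with h | h
      · simp [h]
      · simp [show ¬ (m : ℕ) ≤ 0 by omega]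
    | succ n ih =>
      rw [sum_range_succ, ih]
      by_cases h1 : (m : ℕ) ≤ n
      · simp [h1, show (m : ℕ) ≤ n + 1 by omega]
      · by_cases h2 : (m : ℕ) ≤ n + 1
        · simp [show (m : ℕ) = n + 1 by omega]
        · simp [h1, h2]
  have := Fin.sum_univ_eq_sum_range (fun d => if (m : ℕ) ≤ d then R d - R (d + 1) else 0) (D + 1)
  rw [key, if_pos (by omega)] at this
  simpa only [Fin.le_def] using this

/-- A quantity moved by one place along `0, …, D`, staying at `D` once it is there, arrives at
`e + 1` from `e`, and from `D` if `e + 1 = D`. -/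
lemma sum_fin_aged {D : ℕ} (y : Fin (D + 1) → E) (e : Fin D) :
    ∑ d : Fin (D + 1), (if (⟨min (d + 1) D, by omega⟩ : Fin (D + 1)) = e.succ then y d else 0) =
      y e.castSucc + if (e : ℕ) + 1 = D then y (Fin.last D) else 0 := by
  have : ∀ d : Fin (D + 1),
      (if (⟨min (d + 1) D, by omega⟩ : Fin (D + 1)) = e.succ then y d else 0) =
      (if d = e.castSucc then y d else 0) +
        if d = Fin.last D then (if (e : ℕ) + 1 = D then y d else 0) else 0 := by
    intro d
    have he := e.is_lt
    have hd := d.is_lt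
    simp only [Fin.ext_iff, Fin.val_succ, Fin.val_castSucc, Fin.val_last]
    by_cases h1 : (d : ℕ) = e
    · simp [h1, show ¬ (e : ℕ) = D by omega]
    · by_cases h2 : (d : ℕ) = D
      · by_cases h3 : (e : ℕ) + 1 = D
        · simp [h2, h3, show ¬ D = (e : ℕ) by omega]
        · simp [h2, h3, show ¬ D = (e : ℕ) by omega, show ¬ D = (e : ℕ) + 1 by omega]
      · simp [h1, h2, show ¬ min ((d : ℕ) + 1) D = e + 1 by omega]
  rw [sum_congr rfl fun d _ => this d, sum_add_distrib]
  simp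

/-- The mass on an edge at time `k` which was sent at least `d` iterations ago, in terms of the
cumulative mass `r` and the time stamp `age` of the mass already received, up to the additive
constant `r age`; beyond the maximal delay `D` no mass is left. -/
def massBefore (D : ℕ) (r : ℤ → E) (age k : ℤ) (d : ℕ) : E :=
  if d ≤ D then r (max (k - d) age) else r age

/-- The masses on an edge, sorted by the time since they were sent, age by one in each iteration,
unless the receiver collects all those which were sent at least `δ` iterations ago. -/
lemma massBefore_succ {D : ℕ} (r : ℤ → E) {age age' k : ℤ} (collect : Prop) [Decidable collect]
    (δ : Fin (D + 1)) (hage : collect → age ≤ age') (hnew : collect → age' = k - δ)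
    (hold : ¬ collect → age' = age) (e : Fin D) :
    ∑ d : Fin (D + 1), (if collect ∧ δ ≤ d then 0 else
      if (⟨min (d + 1) D, by omega⟩ : Fin (D + 1)) = e.succ then
        massBefore D r age k d - massBefore D r age k (d + 1) else 0) =
      massBefore D r age' (k + 1) (e + 1) - massBefore D r age' (k + 1) (e + 2) := by
  have hswap : ∀ d : Fin (D + 1), (if collect ∧ δ ≤ d then 0 else
      if (⟨min (d + 1) D, by omega⟩ : Fin (D + 1)) = e.succ then
        massBefore D r age k d - massBefore D r age k (d + 1) else 0) =
      if (⟨min (d + 1) D, by omega⟩ : Fin (D + 1)) = e.succ then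
        (if collect ∧ δ ≤ d then 0 else
          massBefore D r age k d - massBefore D r age k (d + 1)) else 0 := by
    intro d; split_ifs <;> rfl
  rw [sum_congr rfl fun d _ => hswap d, sum_fin_aged]
  have he := e.is_lt
  have hδ := δ.is_lt
  simp only [massBefore, Fin.val_castSucc, Fin.val_last, Fin.le_def, Nat.cast_add, Nat.cast_one,
    Nat.cast_ofNat, le_refl, if_true, show (e : ℕ) ≤ D by omega, show (e : ℕ) + 1 ≤ D by omega,
    show ¬ D + 1 ≤ D by omega, if_false, show (δ : ℕ) ≤ D by omega, and_true]
  by_cases hc : collect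
  · have h1 := hage hc
    have h2 := hnew hc
    subst h2
    simp only [hc, true_and, if_true, ite_self, add_zero]
    by_cases h3 : (δ : ℕ) ≤ e
    · rw [if_pos h3, show max (k + 1 - ((e : ℤ) + 1)) (k - δ) = k - δ by omega,
        show max (k + 1 - ((e : ℤ) + 2)) (k - δ) = k - δ by omega, ite_self, sub_self]
    · rw [if_neg h3, show max (k + 1 - ((e : ℤ) + 1)) (k - δ) = k - e by omega,
        show max (k - (e : ℤ)) age = k - e by omega,
        show max (k - ((e : ℤ) + 1)) age = k - (e + 1) by omega]
      congr 1
      split_ifs with h4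
      · congr 1; omega
      · congr 1; omega
  · have h1 := hold hc
    subst h1
    simp only [hc, false_and, if_false]
    rw [show k + 1 - ((e : ℤ) + 1) = k - e by ring,
      show k + 1 - ((e : ℤ) + 2) = k - (e + 1) by ring]
    by_cases h3 : (e : ℕ) + 1 = D
    · rw [if_pos h3, if_neg (by omega), show ((e : ℤ) + 1) = D by omega]
      abel
    · rw [if_neg h3, if_pos (by omega), add_zero]

end Telescoping

/-! ### The augmented states of a generated sequence -/

section Trajectory

lemma mem_inNbrs {V : Type*} [Fintype V] {G : Digraph V} {i j : V} :
    j ∈ inNbrs G i ↔ G.Adj j i := by simp [inNbrs]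

variable {V : Type*} [Fintype V] [DecidableEq V] {n : ℕ} {G : Digraph V} {W A : Matrix V V ℝ}
  {f : V → EuclideanSpace ℝ (Fin n) → ℝ} {T D : ℕ} {step : ℕ → ℝ} {act : ℕ → V}
  {d : ℕ → V → ℕ} {s : Variables V (EuclideanSpace ℝ (Fin n))}

lemma IsGenerated.age_lt (hs : IsGenerated G W A f D step act d s) (hD : 0 < D) (k : ℕ) {i j : V}
    (hj : G.Adj j i) : s.age k i j < k := by
  rw [← mem_inNbrs] at hj
  induction k with
  | zero => rw [hs.age_init i j hj]; omega
  | succ k ih =>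
    by_cases hi : i = act k
    · subst hi
      rw [hs.age_step k j hj]; omega
    · rw [hs.age_keep k i hi j hj]; omega

/-- The data used at iteration `k` has a delay of at most `D`. -/
lemma IsGenerated.exists_delay (hs : IsGenerated G W A f D step act d s) (hD : 0 < D)
    (hmodel : AsyncModel G T D act d) :
    ∃ δ : ℕ → V → Fin (D + 1), ∀ k j, G.Adj j (act k) →
      s.age (k + 1) (act k) j = (k : ℤ) - (δ k j : ℕ) := by
  have : ∀ k j, ∃ δ : Fin (D + 1), G.Adj j (act k) →
      s.age (k + 1) (act k) j = (k : ℤ) - (δ : ℕ) := by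
    intro k j
    by_cases hj : G.Adj j (act k)
    · have h1 := hs.age_lt hD (k + 1) hj
      have h2 := hs.age_step k j (mem_inNbrs.2 hj)
      have h3 := hmodel.delay k j (mem_inNbrs.2 hj)
      push_cast at h1
      refine ⟨⟨((k : ℤ) - s.age (k + 1) (act k) j).toNat, by omega⟩, fun _ => ?_⟩
      simp only
      omega
    · exact ⟨0, fun h => absurd h hj⟩
  choose δ hδ using this
  exact ⟨δ, hδ⟩

/-- The buffers hold the cumulative masses at the time stamps, so that the difference collected by
the active agent telescopes over the masses in transit. -/
lemma IsGenerated.rhoBuf_eq (hs : IsGenerated G W A f D step act d s) (k : ℕ) {i j : V}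
    (hj : G.Adj j i) : s.rhoBuf k i j = s.rho (s.age k i j) i j := by
  rw [← mem_inNbrs] at hj
  induction k with
  | zero =>
    rw [hs.rhoBuf_init i j hj, hs.age_init i j hj, hs.rho_init _ le_rfl (by omega) i j hj]
  | succ k ih =>
    by_cases hi : i = act k
    · subst hi
      exact hs.rhoBuf_step k j hj
    · rw [hs.rhoBuf_keep k i hi j hj, hs.age_keep k i hi j hj, ih]

/-- The iterates of all agents and their descent variables at the last `D + 1` times. -/
def consensusState {E : Type*} (D : ℕ) (s : Variables V E) (k : ℕ) : V ⊕ V × Fin (D + 1) → E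
  | Sum.inl i => s.x k i
  | Sum.inr (i, d) => s.v ((k : ℤ) - (d : ℕ)) i

/-- Averaging is a linear recursion of the augmented state, with the descent step of the active
agent as input before the averaging. -/
lemma IsGenerated.consensusState_succ (hs : IsGenerated G W A f D step act d s)
    (hloop : NoSelfLoops G) {mbar : ℝ} (hW : Compliant G mbar W) {δ : ℕ → V → Fin (D + 1)}
    (hδ : ∀ k j, G.Adj j (act k) → s.age (k + 1) (act k) j = (k : ℤ) - (δ k j : ℕ)) (k : ℕ) :
    consensusState D s (k + 1) = consensusMatrix W (act k) (δ k) •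
      (consensusState D s k +
        Pi.single (Sum.inl (act k)) (-(step k • s.z k (act k)))) := by
  funext b
  rw [consensusMatrix_smul_apply]
  have hv := hs.v_step k
  have hinl : (consensusState D s k + Pi.single (Sum.inl (act k))
      (-(step k • s.z k (act k))) : _ → EuclideanSpace ℝ (Fin n)) (Sum.inl (act k)) =
      s.v ((k : ℤ) + 1) (act k) := by
    rw [hv, Pi.add_apply, Pi.single_eq_same, ← sub_eq_add_neg, consensusState]
  rcases b with i | ⟨i, d⟩
  · by_cases hi : i = act k
    · subst hi
      simp only [if_true]
      rw [consensusState, hs.x_step k, ← add_sum_erase _ _ (mem_univ (act k))]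
      congr 1
      · rw [readNode, if_pos rfl, hinl]
      · have hsub : inNbrs G (act k) ⊆ univ.erase (act k) := fun j hj => by
          rw [mem_erase]
          exact ⟨fun h => hloop _ (h ▸ mem_inNbrs.1 hj), mem_univ _⟩
        rw [← sum_subset hsub]
        · refine sum_congr rfl fun j hj => ?_
          have hne : j ≠ act k := (mem_erase.1 (hsub hj)).1
          rw [readNode, if_neg hne, hδ k j (mem_inNbrs.1 hj)]
          simp [consensusState]
        · intro j hj hj'
          rw [hW.zero _ _ (mem_erase.1 hj).1.symm (fun h => hj' (mem_inNbrs.2 h)), zero_smul]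
    · rw [if_neg (by simpa using hi)]
      simp [prevNode, consensusState, hi, hs.x_keep k i hi]
  · rw [if_neg (by simp)]
    induction d using Fin.cases with
    | zero =>
      by_cases hi : i = act k
      · subst hi
        simp only [prevNode, Fin.cases_zero, if_true]
        rw [hinl]
        simp [consensusState]
      · simp [prevNode, consensusState, hi, hs.v_keep k i hi]
    | succ d => simp [prevNode, consensusState]

open Classical in
/-- The masses of all agents and the masses on the edges, sorted by the time since they were
sent. The pairs of agents which are not edges carry no mass. -/
noncomputable def trackingState {E : Type*} [AddCommGroup E] (G : Digraph V) (D : ℕ)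
    (s : Variables V E) (k : ℕ) : V ⊕ (V × V) × Fin (D + 1) → E
  | Sum.inl i => s.z k i
  | Sum.inr ((j, l), d) =>
    if G.Adj j l then
      massBefore D (fun t => s.rho t l j) (s.age k l j) k d -
        massBefore D (fun t => s.rho t l j) (s.age k l j) k (d + 1)
    else 0

/-- The mass collected by the active agent is its intermediate mass. -/
lemma IsGenerated.sum_gathered (hs : IsGenerated G W A f D step act d s)
    {δ : ℕ → V → Fin (D + 1)}
    (hδ : ∀ k j, G.Adj j (act k) → s.age (k + 1) (act k) j = (k : ℤ) - (δ k j : ℕ)) (k : ℕ) :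
    (∑ a, if Gathered (act k) (δ k) a then (trackingState G D s k +
        Pi.single (Sum.inl (act k)) (gradient (f (act k)) (s.x (k + 1) (act k)) -
          gradient (f (act k)) (s.x k (act k))) : _ → EuclideanSpace ℝ (Fin n)) a else 0) =
      s.zHalf k := by
  classical
  rw [hs.zHalf_step k, Fintype.sum_sum_type, Fintype.sum_prod_type, Fintype.sum_prod_type,
    add_right_comm]
  congr 1
  · rw [sum_eq_single (act k) (by intro l _ hl; simp [Gathered, hl]) (by simp)]
    simp [Gathered, trackingState]
  · have : inNbrs G (act k) = univ.filter fun j => G.Adj j (act k) := by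
      ext j; simp [mem_inNbrs]
    rw [this, sum_filter]
    refine sum_congr rfl fun j _ => ?_
    rw [sum_eq_single (act k) (by intro l _ hl; simp [Gathered, hl]) (by simp)]
    by_cases hj : G.Adj j (act k)
    · simp only [Gathered, true_and, trackingState, Pi.add_apply, hj, if_true]
      rw [sum_congr rfl fun d _ => by rw [Pi.single_eq_of_ne (by simp), add_zero],
        sum_fin_ite_le_telescope (fun d => massBefore D _ _ _ d) (δ k j), hs.rhoBuf_eq k hj]
      have h1 := hs.age_step k j (mem_inNbrs.2 hj)
      have h2 := hδ k j hj
      have h3 := (δ k j).is_lt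
      rw [massBefore, if_pos (by omega), massBefore, if_neg (by omega), ← h2]
      congr 2
      rw [h1]
      exact max_eq_left (le_max_left _ _)
    · simp [hj, trackingState]

/-- Tracking is a linear recursion of the augmented state, with the change of the gradient of the
active agent as input before the distribution. -/
lemma IsGenerated.trackingState_succ (hs : IsGenerated G W A f D step act d s)
    (hloop : NoSelfLoops G) (hD : 0 < D) {mbar : ℝ} (hA : Compliant G mbar A)
    {δ : ℕ → V → Fin (D + 1)}
    (hδ : ∀ k j, G.Adj j (act k) → s.age (k + 1) (act k) j = (k : ℤ) - (δ k j : ℕ)) (k : ℕ) :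
    trackingState G D s (k + 1) = trackingMatrix A (act k) (δ k) • (trackingState G D s k +
        Pi.single (Sum.inl (act k)) (gradient (f (act k)) (s.x (k + 1) (act k)) -
          gradient (f (act k)) (s.x k (act k)))) := by
  classical
  funext b
  rw [trackingMatrix_smul_apply, hs.sum_gathered hδ k]
  rcases b with l | ⟨⟨j, l⟩, d'⟩
  · have h2 : ∀ a : V ⊕ (V × V) × Fin (D + 1), agedNode a = Sum.inl l ↔ a = Sum.inl l := by
      rintro (a | ⟨e, d⟩) <;> simp [agedNode]
    by_cases hl : l = act k
    · subst hl
      have h1 : ∀ m : V, (pushNode (act k) m : V ⊕ (V × V) × Fin (D + 1)) = Sum.inl (act k) ↔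
          m = act k := by
        intro m; rw [pushNode]; split_ifs with h <;> simp [h]
      have h3 : ∀ a : V ⊕ (V × V) × Fin (D + 1), a = Sum.inl (act k) →
          Gathered (act k) (δ k) a := by
        rintro a rfl; rfl
      simp only [h1, h2]
      rw [sum_eq_zero (s := univ) (f := fun a : V ⊕ (V × V) × Fin (D + 1) => ite _ _ _)]
      · simp [trackingState, hs.z_step k]
      · intro a _
        by_cases ha : a = Sum.inl (act k)
        · simp [h3 a ha]
        · simp [ha]
    · have h1 : ∀ m : V, ¬ (pushNode (act k) m : V ⊕ (V × V) × Fin (D + 1)) = Sum.inl l := by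
        intro m; rw [pushNode]; split_ifs with h <;> simp [Ne.symm hl]
      simp only [h1, h2]
      rw [sum_eq_single (Sum.inl l : V ⊕ (V × V) × Fin (D + 1))]
      · simp [trackingState, Gathered, hl, hs.z_keep k l hl]
      · intro a _ ha; simp [ha]
      · simp
  · -- of the old masses, only those on the same edge can age into `(j, l)`
    have hold : (∑ a, if Gathered (act k) (δ k) a then 0 else
        if agedNode a = Sum.inr ((j, l), d') then (trackingState G D s k +
          Pi.single (Sum.inl (act k)) (gradient (f (act k)) (s.x (k + 1) (act k)) -
          gradient (f (act k)) (s.x k (act k))) : _ → EuclideanSpace ℝ (Fin n)) a else 0) =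
        ∑ d : Fin (D + 1), if l = act k ∧ δ k j ≤ d then 0 else
          if (⟨min (d + 1) D, by omega⟩ : Fin (D + 1)) = d' then
            trackingState G D s k (Sum.inr ((j, l), d)) else 0 := by
      rw [Fintype.sum_sum_type, Fintype.sum_prod_type, sum_eq_single (j, l)]
      · simp [Gathered, agedNode]
      · intro e _ he
        refine sum_eq_zero fun d _ => ?_
        simp [agedNode, he]
      · simp
    rw [hold]
    by_cases hjl : G.Adj j l
    · have hne : j ≠ l := fun h => hloop _ (h ▸ hjl)
      have h1 := hs.age_lt hD (k + 1) hjl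
      simp only [trackingState, hjl, if_true]
      induction d' using Fin.cases with
      | zero =>
        have hz : ∀ d : Fin (D + 1), (⟨min (d + 1) D, by omega⟩ : Fin (D + 1)) ≠ 0 := by
          intro d h
          have := congrArg Fin.val h
          simp only [Fin.val_zero] at this
          omega
        -- as `1 ≤ D`, no old mass ages into delay `0`: what is there has just been sent
        simp only [hz, if_false, ite_self, sum_const_zero, add_zero]
        simp only [massBefore, Fin.val_zero, Nat.cast_zero, sub_zero, Nat.cast_add, Nat.cast_one,
          zero_le, if_true, zero_add, show 1 ≤ D from hD]
        push_cast at h1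
        rw [max_eq_left (by omega), add_sub_cancel_right, max_eq_left (by omega)]
        by_cases hj : j = act k
        · subst hj
          have h2 : ∀ m : V, (pushNode (act k) m : V ⊕ (V × V) × Fin (D + 1)) =
              Sum.inr ((act k, l), 0) ↔ m = l := by
            intro m; rw [pushNode]; split_ifs with h
            · subst h; simpa using hne
            · simp
          simp [h2, hs.rho_step k l hjl]
        · have h2 : ∀ m : V, ¬ (pushNode (act k) m : V ⊕ (V × V) × Fin (D + 1)) =
              Sum.inr ((j, l), 0) := by
            intro m; rw [pushNode]; split_ifs with h <;> simp [Ne.symm hj]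
          simp [h2, hs.rho_keep k j hj l hjl]
      | succ e =>
        have h2 : ∀ m : V, ¬ (pushNode (act k) m : V ⊕ (V × V) × Fin (D + 1)) =
            Sum.inr ((j, l), e.succ) := by
          intro m; rw [pushNode]; split_ifs with h <;> simp [(Fin.succ_ne_zero e).symm]
        simp only [h2, if_false, sum_const_zero, zero_smul, zero_add]
        rw [massBefore_succ (fun t => s.rho t l j) (age' := s.age (k + 1) l j) (l = act k) (δ k j)]
        · simp
        · rintro rfl
          rw [hs.age_step k j (mem_inNbrs.2 hjl)]
          exact le_max_left _ _
        · rintro rfl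
          exact hδ k j hjl
        · intro hl
          exact hs.age_keep k l hl j (mem_inNbrs.2 hjl)
    · simp only [trackingState, hjl, if_false, ite_self, sum_const_zero, add_zero]
      rw [sum_eq_zero, zero_smul]
      intro m _
      split_ifs with h
      · rw [pushNode] at h
        split_ifs at h with hm
        simp only [Sum.inr.injEq, Prod.mk.injEq] at h
        obtain ⟨⟨rfl, rfl⟩, -⟩ := h
        exact hA.zero _ _ hm hjl
      · rfl

/-- The total mass is the sum of the local gradients. -/
lemma IsGenerated.sum_trackingState (hs : IsGenerated G W A f D step act d s)
    (hloop : NoSelfLoops G) (hD : 0 < D) {mbar : ℝ} (hm : 0 < mbar) (hA : Compliant G mbar A)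
    (hA1 : ∀ j, ∑ i, A i j = 1) {δ : ℕ → V → Fin (D + 1)}
    (hδ : ∀ k j, G.Adj j (act k) → s.age (k + 1) (act k) j = (k : ℤ) - (δ k j : ℕ)) (k : ℕ) :
    ∑ a, trackingState G D s k a = ∑ i, gradient (f i) (s.x k i) := by
  classical
  induction k with
  | zero =>
    rw [Fintype.sum_sum_type]
    have h0 : ∀ p : (V × V) × Fin (D + 1), trackingState G D s 0 (Sum.inr p) = 0 := by
      rintro ⟨⟨j, l⟩, e⟩
      by_cases hjl : G.Adj j l
      · have hm := mem_inNbrs.2 hjl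
        have h1 : ∀ c, massBefore D (fun t => s.rho t l j) (s.age 0 l j) (0 : ℕ) c = 0 := by
          intro c
          have := hs.age_init l j hm
          unfold massBefore
          split_ifs <;> exact hs.rho_init _ (by omega) (by push_cast; omega) l j hm
        simp only [trackingState, hjl, if_true, h1, sub_zero]
      · simp [trackingState, hjl]
    simp only [h0, sum_const_zero, add_zero]
    simp [trackingState, hs.z_init]
  | succ k ih =>
    rw [hs.trackingState_succ hloop hD hA hδ,
      sum_smul_of_mem_colStochastic (trackingMatrix_mem (hA.nonneg hm) hA1 _ _)]
    simp only [Pi.add_apply]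
    rw [sum_add_distrib, ih, sum_pi_single' (Sum.inl (act k)) _ univ, if_pos (mem_univ _),
      ← add_sum_erase univ (fun i => gradient (f i) (s.x k i)) (mem_univ (act k)),
      ← add_sum_erase univ (fun i => gradient (f i) (s.x (k + 1) i)) (mem_univ (act k)),
      sum_congr rfl fun i hi => by rw [← hs.x_keep k i (mem_erase.1 hi).1]]
    abel

end Trajectory

/-! ### Consensus and tracking errors -/

section ErrorBounds
variable {V : Type*} [Fintype V]

lemma norm_sum_gradient_sub_le {n : ℕ} {f : V → EuclideanSpace ℝ (Fin n) → ℝ} {L : V → ℝ≥0}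
    (hL : ∀ i, LipschitzWith (L i) (gradient (f i))) {a b : V → EuclideanSpace ℝ (Fin n)} {r : ℝ}
    (hr : ∀ i, ‖a i - b i‖ ≤ r) :
    ‖∑ i, gradient (f i) (a i) - ∑ i, gradient (f i) (b i)‖ ≤ (∑ i, (L i : ℝ)) * r := by
  rw [← sum_sub_distrib, sum_mul]
  refine norm_sum_le_of_le _ fun i _ => ((hL i).norm_sub_le _ _).trans ?_
  exact mul_le_mul_of_nonneg_left (hr i) (L i).2

/-- The families with sum zero. -/
def zeroSum (S E : Type*) [Fintype S] [AddCommGroup E] : AddSubgroup (S → E) where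
  carrier := {y | ∑ a, y a = 0}
  zero_mem' := by simp
  add_mem' {x y} hx hy := by
    have hx : ∑ a, x a = 0 := hx
    have hy : ∑ a, y a = 0 := hy
    change ∑ a, (x a + y a) = 0
    rw [sum_add_distrib, hx, hy, add_zero]
  neg_mem' {x} hx := by
    have hx : ∑ a, x a = 0 := hx
    change ∑ a, -x a = 0
    rw [sum_neg_distrib, hx, neg_zero]

lemma mem_zeroSum {S E : Type*} [Fintype S] [AddCommGroup E] {y : S → E} :
    y ∈ zeroSum S E ↔ ∑ a, y a = 0 := Iff.rfl

variable [DecidableEq V] {n : ℕ} {G : Digraph V} {W A : Matrix V V ℝ}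
  {f : V → EuclideanSpace ℝ (Fin n) → ℝ} {T D : ℕ} {γ mbar : ℝ} {act : ℕ → V}
  {d : ℕ → V → ℕ} {s : Variables V (EuclideanSpace ℝ (Fin n))}

/-- The consensus error, measured by the diameter of the augmented state, contracts up to the
steps taken. -/
lemma IsGenerated.diam_consensusState_le [Nonempty V]
    (hs : IsGenerated G W A f D (fun _ => γ) act d s)
    (hloop : NoSelfLoops G) (hconn : StronglyConnected G) (hm : 0 < mbar) (hD : 0 < D)
    (hWA : Weights G mbar W A) (hmodel : AsyncModel G T D act d) (hγ : 0 < γ) (k : ℕ) :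
    diam (consensusState D s (k + K1 (Fintype.card V) T D)) ≤
      (1 - eta mbar (Fintype.card V) T D) * diam (consensusState D s k) +
        ∑ m ∈ range (K1 (Fintype.card V) T D), 2 * (γ * ‖s.z (k + m) (act (k + m))‖) := by
  obtain ⟨δ, hδ⟩ := hs.exists_delay hD hmodel
  have hmem := fun k => consensusMatrix_mem (hWA.compliantW.nonneg hm) hWA.rowStochastic
    (act k) (δ k)
  refine (gauge_window_le (M := fun k => consensusMatrix W (act k) (δ k))
    (gauge := diam) (θ := 1 - eta mbar (Fintype.card V) T D) ⊤ ?_ diam_add_le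
    (fun _ _ _ => AddSubgroup.mem_top _) (fun k h _ => diam_smul_le (hmem k) h) ?_
    (fun _ => AddSubgroup.mem_top _) (fun _ => AddSubgroup.mem_top _)
    (hs.consensusState_succ hloop hWA.compliantW hδ) k).trans ?_
  · exact le_antisymm (diam_le le_rfl fun a b => by simp) (diam_nonneg _)
  · intro k h _
    obtain ⟨i⟩ := ‹Nonempty V›
    exact diam_smul_le_of_column (transition_mem hmem _ _) (j := Sum.inl i)
      (fun b => eta_le_transition_consensusMatrix hloop hconn hm hWA.compliantW hWA.rowStochastic
        hmodel.activation δ k i b) h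
  · refine add_le_add le_rfl (sum_le_sum fun m _ => (diam_single_le _ _).trans_eq ?_)
    rw [norm_neg, norm_smul, Real.norm_of_nonneg hγ.le]

/-- The change of the iterate of the active agent. -/
lemma IsGenerated.norm_x_succ_sub_le (hs : IsGenerated G W A f D (fun _ => γ) act d s)
    (hloop : NoSelfLoops G) (hm : 0 < mbar) (hD : 0 < D)
    (hWA : Weights G mbar W A) (hmodel : AsyncModel G T D act d) (hγ : 0 < γ) (k : ℕ) :
    ‖s.x (k + 1) (act k) - s.x k (act k)‖ ≤
      diam (consensusState D s k) + γ * ‖s.z k (act k)‖ := by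
  obtain ⟨δ, hδ⟩ := hs.exists_delay hD hmodel
  have hmem := consensusMatrix_mem (hWA.compliantW.nonneg hm) hWA.rowStochastic (act k) (δ k)
  have hrow := mem_rowStochastic_iff_sum.1 hmem
  have hx : s.x (k + 1) (act k) = ∑ a, consensusMatrix W (act k) (δ k) (Sum.inl (act k)) a •
      consensusState D s k a + consensusMatrix W (act k) (δ k) (Sum.inl (act k)) (Sum.inl (act k)) •
        (-(γ • s.z k (act k))) := by
    have := congrFun (hs.consensusState_succ hloop hWA.compliantW hδ k) (Sum.inl (act k))
    rw [smul_add, Pi.add_apply, Matrix.Module.smul_apply, Matrix.Module.smul_apply] at this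
    rw [consensusState] at this
    rw [this]
    congr 1
    rw [sum_eq_single (Sum.inl (act k)) (fun a _ ha => by simp [ha]) (by simp), Pi.single_eq_same]
  have h1 := norm_sum_smul_sub_le_diam (hrow.1 (Sum.inl (act k))) (hrow.2 _)
    (consensusState D s k) (Sum.inl (act k))
  rw [hx, add_sub_right_comm]
  refine (norm_add_le _ _).trans (add_le_add h1 ?_)
  rw [norm_smul, norm_neg, norm_smul, Real.norm_of_nonneg hγ.le, Real.norm_of_nonneg (hrow.1 _ _)]
  exact mul_le_of_le_one_left (by positivity) (le_one_of_mem_rowStochastic hmem)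

/-- Up to a finite horizon `N`, a weighted average of the augmented state moves by multiples of the
descent directions, with factors at least `η`. -/
lemma IsGenerated.exists_average [Nonempty V] (hs : IsGenerated G W A f D (fun _ => γ) act d s)
    (hloop : NoSelfLoops G) (hconn : StronglyConnected G) (hm : 0 < mbar) (hD : 0 < D)
    (hWA : Weights G mbar W A) (hmodel : AsyncModel G T D act d) (N : ℕ) :
    ∃ (xbar : ℕ → EuclideanSpace ℝ (Fin n)) (ψ : ℕ → ℝ),
      (∀ k i, ‖xbar k - s.x k i‖ ≤ diam (consensusState D s k)) ∧
      (∀ k < N, eta mbar (Fintype.card V) T D ≤ ψ k ∧ ψ k ≤ 1 ∧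
        xbar (k + 1) = xbar k - (γ * ψ k) • s.z k (act k)) := by
  obtain ⟨δ, hδ⟩ := hs.exists_delay hD hmodel
  have hmem := fun k => consensusMatrix_mem (hWA.compliantW.nonneg hm) hWA.rowStochastic
    (act k) (δ k)
  obtain ⟨ψ, hψ0, hψ1, hψM, hψη⟩ := exists_backward_weights hmem (N + K1 (Fintype.card V) T D)
  refine ⟨fun k => ∑ a, ψ k a • consensusState D s k a, fun k => ψ k (Sum.inl (act k)),
    fun k i => norm_sum_smul_sub_le_diam (hψ0 k) (hψ1 k) _ (Sum.inl i), fun k hk => ⟨?_, ?_, ?_⟩⟩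
  · exact hψη k (K1 (Fintype.card V) T D) _ _ (by omega) fun b =>
      eta_le_transition_consensusMatrix hloop hconn hm hWA.compliantW hWA.rowStochastic
        hmodel.activation δ k (act k) b
  · exact hψ1 k ▸ single_le_sum (fun a _ => hψ0 k a) (mem_univ _)
  · have hmove : ∀ g : V ⊕ V × Fin (D + 1) → EuclideanSpace ℝ (Fin n),
        ∑ b, ψ (k + 1) b • (consensusMatrix W (act k) (δ k) • g) b = ∑ a, ψ k a • g a := by
      intro g
      simp only [Matrix.Module.smul_apply, smul_sum, smul_smul]
      rw [sum_comm]
      refine sum_congr rfl fun a _ => ?_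
      rw [← sum_smul, hψM k (by omega)]
    simp only
    rw [hs.consensusState_succ hloop hWA.compliantW hδ k, hmove]
    simp only [Pi.add_apply, smul_add, sum_add_distrib]
    rw [sum_eq_single (f := fun a => ψ k a • (Pi.single (Sum.inl (act k))
        (-(γ • s.z k (act k))) : _ → EuclideanSpace ℝ (Fin n)) a) (Sum.inl (act k))
        (fun a _ ha => by simp [ha]) (by simp), Pi.single_eq_same, smul_neg, smul_smul,
        ← sub_eq_add_neg, mul_comm γ]

/-- The masses of the agents track fractions, at least `η` after `K₁` iterations, of the sum of the
local gradients. The tracking error contracts up to the changes of the gradients. -/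
lemma IsGenerated.exists_tracking_error [Nonempty V]
    (hs : IsGenerated G W A f D (fun _ => γ) act d s)
    (hloop : NoSelfLoops G) (hconn : StronglyConnected G) (hm : 0 < mbar) (hD : 0 < D)
    (hWA : Weights G mbar W A) (hmodel : AsyncModel G T D act d) :
    ∃ (ξ : ℕ → V → ℝ) (t : ℕ → ℝ), (∀ k i, 0 ≤ ξ k i ∧ ξ k i ≤ 1) ∧ (∀ k, 0 ≤ t k) ∧
      (∀ k i, K1 (Fintype.card V) T D ≤ k → eta mbar (Fintype.card V) T D ≤ ξ k i) ∧
      (∀ k i, ‖s.z k i - ξ k i • ∑ j, gradient (f j) (s.x k j)‖ ≤ t k) ∧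
      ∀ k, t (k + K1 (Fintype.card V) T D) ≤ (1 - eta mbar (Fintype.card V) T D) * t k +
        ∑ m ∈ range (K1 (Fintype.card V) T D),
          2 * ‖gradient (f (act (k + m))) (s.x (k + m + 1) (act (k + m))) -
            gradient (f (act (k + m))) (s.x (k + m) (act (k + m)))‖ := by
  obtain ⟨δ, hδ⟩ := hs.exists_delay hD hmodel
  have hm1 := hWA.compliantW.le_one hm hWA.rowStochastic
  have hmem := fun k => trackingMatrix_mem (hWA.compliantA.nonneg hm) hWA.colStochastic
    (act k) (δ k)
  have hη := eta_le_transition_trackingMatrix hloop hconn hm hm1 hWA.compliantA hWA.colStochastic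
    hmodel.activation δ
  obtain ⟨ξ, hξ0, hξ1, hξM, hξη⟩ := exists_forward_weights hmem
  set M := fun k => trackingMatrix A (act k) (δ k) with hM
  set ε : ℕ → EuclideanSpace ℝ (Fin n) := fun k => gradient (f (act k)) (s.x (k + 1) (act k)) -
    gradient (f (act k)) (s.x k (act k)) with hε
  set g : ℕ → EuclideanSpace ℝ (Fin n) := fun k => ∑ j, gradient (f j) (s.x k j) with hg
  have hgsum : ∀ k, ∑ a, trackingState G D s k a = g k :=
    hs.sum_trackingState hloop hD hm hWA.compliantA hWA.colStochastic hδ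
  have hrec : ∀ k, trackingState G D s (k + 1) =
      M k • (trackingState G D s k + Pi.single (Sum.inl (act k)) (ε k)) :=
    hs.trackingState_succ hloop hD hWA.compliantA hδ
  have hsingle : ∀ k, ∑ a, (Pi.single (Sum.inl (act k)) (ε k) :
      V ⊕ (V × V) × Fin (D + 1) → EuclideanSpace ℝ (Fin n)) a = ε k := by
    intro k
    rw [sum_pi_single' (Sum.inl (act k)) _ univ, if_pos (mem_univ _)]
  have hgsucc : ∀ k, g (k + 1) = g k + ε k := by
    intro k
    rw [← hgsum, hrec, sum_smul_of_mem_colStochastic (hmem k)]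
    simp only [Pi.add_apply]
    rw [sum_add_distrib, hgsum, hsingle]
  have hξsmul : ∀ k (v : EuclideanSpace ℝ (Fin n)), (M k • fun a => ξ k a • v) =
      fun b => ξ (k + 1) b • v := by
    intro k v
    funext b
    rw [Matrix.Module.smul_apply, hξM, sum_smul]
    exact sum_congr rfl fun a _ => smul_smul _ _ _
  set y : ℕ → V ⊕ (V × V) × Fin (D + 1) → EuclideanSpace ℝ (Fin n) :=
    fun k => trackingState G D s k - fun a => ξ k a • g k with hy
  set u : ℕ → V ⊕ (V × V) × Fin (D + 1) → EuclideanSpace ℝ (Fin n) :=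
    fun k => Pi.single (Sum.inl (act k)) (ε k) - fun a => ξ k a • ε k with hu
  have hyrec : ∀ k, y (k + 1) = M k • (y k + u k) := by
    intro k
    have : y k + u k = (trackingState G D s k + Pi.single (Sum.inl (act k)) (ε k)) -
        fun a => ξ k a • g (k + 1) := by
      rw [hgsucc]
      funext a
      simp only [hy, hu, Pi.add_apply, Pi.sub_apply, smul_add]
      abel
    rw [this, smul_sub, ← hrec, hξsmul]
  refine ⟨fun k i => ξ k (Sum.inl i), fun k => ∑ a, ‖y k a‖, fun k i => ⟨hξ0 _ _, ?_⟩,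
    fun k => sum_nonneg fun a _ => norm_nonneg _, ?_, ?_, ?_⟩
  · exact hξ1 k ▸ single_le_sum (fun a _ => hξ0 k a) (mem_univ _)
  · intro k i hk
    obtain ⟨m, rfl⟩ : ∃ m, k = m + K1 (Fintype.card V) T D :=
      ⟨k - K1 (Fintype.card V) T D, by omega⟩
    exact hξη m _ _ _ (hη m i)
  · intro k i
    have hyk : s.z k i - ξ k (Sum.inl i) • ∑ j, gradient (f j) (s.x k j) = y k (Sum.inl i) := rfl
    rw [hyk]
    exact single_le_sum (f := fun a => ‖y k a‖) (fun a _ => norm_nonneg _) (mem_univ _)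
  · intro k
    refine (gauge_window_le (M := M) (gauge := fun y => ∑ a, ‖y a‖)
      (θ := 1 - eta mbar (Fintype.card V) T D)
      (zeroSum _ _) (by simp) ?_ ?_ ?_ ?_ ?_ ?_ hyrec k).trans ?_
    · intro x y
      rw [← sum_add_distrib]
      exact sum_le_sum fun a _ => norm_add_le _ _
    · intro k y hy
      rw [mem_zeroSum] at hy ⊢
      rw [sum_smul_of_mem_colStochastic (hmem k), hy]
    · intro k y hy
      obtain ⟨i⟩ := ‹Nonempty V›
      simpa using sum_norm_smul_le_of_row (hmem k) (η := 0) (j := Sum.inl i)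
        (fun a => nonneg_of_mem_colStochastic (hmem k)) hy
    · intro k y hy
      obtain ⟨i⟩ := ‹Nonempty V›
      exact sum_norm_smul_le_of_row (transition_mem hmem _ _) (hη k i) hy
    · intro k
      rw [mem_zeroSum]
      simp only [hy, Pi.sub_apply]
      rw [sum_sub_distrib, hgsum, ← sum_smul, hξ1, one_smul, sub_self]
    · intro k
      rw [mem_zeroSum]
      simp only [hu, Pi.sub_apply]
      rw [sum_sub_distrib, hsingle, ← sum_smul, hξ1, one_smul, sub_self]
    · refine add_le_add le_rfl (sum_le_sum fun m _ => ?_)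
      simp only [hu, Pi.sub_apply]
      calc ∑ a, ‖(Pi.single (Sum.inl (act (k + m))) (ε (k + m)) :
              V ⊕ (V × V) × Fin (D + 1) → EuclideanSpace ℝ (Fin n)) a - ξ (k + m) a • ε (k + m)‖
          ≤ ∑ a, (‖(Pi.single (Sum.inl (act (k + m))) (ε (k + m)) :
              V ⊕ (V × V) × Fin (D + 1) → EuclideanSpace ℝ (Fin n)) a‖ +
              ξ (k + m) a * ‖ε (k + m)‖) := by
            refine sum_le_sum fun a _ => (norm_sub_le _ _).trans_eq ?_
            rw [norm_smul, Real.norm_of_nonneg (hξ0 _ _)]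
        _ = 2 * ‖ε (k + m)‖ := by
            rw [sum_add_distrib, ← sum_mul, hξ1, sum_eq_single (Sum.inl (act (k + m)))
              (fun a _ ha => by simp [ha]) (by simp), Pi.single_eq_same]
            ring

end ErrorBounds

/-! ### The convergence rate -/

section Rate
variable {V : Type*} [Fintype V] [Nonempty V]

lemma K1_pos {T D : ℕ} (hD : 0 < D) : 0 < K1 (Fintype.card V) T D := by
  have : 0 < Fintype.card V * D := Nat.mul_pos Fintype.card_pos hD
  unfold K1
  omega

lemma distToConsensus_le {n : ℕ} (x : V → EuclideanSpace ℝ (Fin n)) (xs : EuclideanSpace ℝ (Fin n))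
    {r : ℝ} (hr : ∀ i, ‖x i - xs‖ ≤ r) : distToConsensus x xs ≤ Real.sqrt (Fintype.card V) * r := by
  have hr0 : 0 ≤ r := (norm_nonneg _).trans (hr (Classical.arbitrary V))
  unfold distToConsensus
  calc Real.sqrt (∑ i, ‖x i - xs‖ ^ 2) ≤ Real.sqrt (∑ _i : V, r ^ 2) :=
        Real.sqrt_le_sqrt (sum_le_sum fun i _ => pow_le_pow_left₀ (norm_nonneg _) (hr i) 2)
    _ = Real.sqrt (Fintype.card V) * r := by
        rw [sum_const, card_univ, nsmul_eq_mul, Real.sqrt_mul (by positivity), Real.sqrt_sq hr0]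

/-- Below a step-size threshold that only depends on the digraph and the constants, the iterates
converge to the minimizer at the rate `1 - τ * η ^ 2 * γ / 2`. -/
lemma exists_stepsize_isBigO (G : Digraph V) (hloop : NoSelfLoops G) (hconn : StronglyConnected G)
    {mbar : ℝ} (hm : 0 < mbar) (hm1 : mbar ≤ 1) (T : ℕ) {D : ℕ} (hD : 0 < D) (L : V → ℝ≥0) {τ : ℝ}
    (hτ : 0 < τ) :
    ∃ γ₀ > 0, τ * eta mbar (Fintype.card V) T D ^ 2 * γ₀ ≤ 1 ∧
      ∀ W A : Matrix V V ℝ, Weights G mbar W A →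
      ∀ (n : ℕ) (f : V → EuclideanSpace ℝ (Fin n) → ℝ),
      (∀ i, Differentiable ℝ (f i)) → (∀ i, LipschitzWith (L i) (gradient (f i))) →
      StrongConvexOn Set.univ τ (fun x => ∑ i, f i x) →
      ∀ xs : EuclideanSpace ℝ (Fin n), ∑ i, gradient (f i) xs = 0 →
      ∀ (act : ℕ → V) (d : ℕ → V → ℕ), AsyncModel G T D act d →
      ∀ γ, 0 < γ → γ ≤ γ₀ → ∀ s : Variables V (EuclideanSpace ℝ (Fin n)),
      IsGenerated G W A f D (fun _ => γ) act d s →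
      (fun k : ℕ => distToConsensus (s.x k) xs) =O[atTop]
        (fun k : ℕ => (1 - τ * eta mbar (Fintype.card V) T D ^ 2 * γ / 2) ^ k) := by
  classical
  set K := K1 (Fintype.card V) T D with hK
  set η := eta mbar (Fintype.card V) T D with hη
  have hη0 : 0 < η := pow_pos hm _
  have hη1 : η ≤ 1 := pow_le_one₀ hm.le hm1
  set Λ : ℝ := ∑ i, (L i : ℝ) with hΛ
  have hΛ0 : 0 ≤ Λ := sum_nonneg fun i _ => (L i).2
  obtain ⟨γ₁, hγ₁, hμγ₁, H⟩ := exists_stepsize_linear_rate (K1_pos (V := V) (T := T) hD)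
    hη0 hη1 hΛ0 (show 0 < τ * η ^ 2 by positivity)
  -- the last two bounds make gradient steps of length at most `γ` contract
  refine ⟨min γ₁ (min (1 / τ) (τ / (2 * (Λ ^ 2 + 1)))), by positivity, ?_, ?_⟩
  · exact (mul_le_mul_of_nonneg_left (min_le_left _ _) (by positivity)).trans hμγ₁
  intro W A hWA n f hdiff hlip hconv xs hxs act d hmodel γ hγ hγle s hs
  obtain ⟨hγ1, hγ2⟩ := le_min_iff.1 hγle
  obtain ⟨hγ2, hγ3⟩ := le_min_iff.1 hγ2
  have hγτ : γ * τ ≤ 1 := by rwa [le_div_iff₀ hτ] at hγ2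
  have hγΛ : γ * Λ ^ 2 ≤ τ / 2 := by
    rw [le_div_iff₀ (by positivity)] at hγ3
    linarith
  have hgrad : ∀ x, HasGradientAt (fun x => ∑ i, f i x) (∑ i, gradient (f i) x) x := fun x =>
    hasGradientAt_sum _ fun i _ => (hdiff i x).hasGradientAt
  have hgradΛ : ∀ x, ‖∑ i, gradient (f i) x‖ ≤ Λ * ‖x - xs‖ := by
    intro x
    have := norm_sum_gradient_sub_le hlip (a := fun _ => x) (b := fun _ => xs) (fun _ => le_rfl)
    rwa [hxs, sub_zero] at this
  obtain ⟨ξ, t, hξ, ht0, hξη, hzξ, ht⟩ :=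
    hs.exists_tracking_error hloop hconn hm hD hWA hmodel
  set c : ℕ → ℝ := fun k => diam (consensusState D s k) with hc
  have hc0 : ∀ k, 0 ≤ c k := fun k => diam_nonneg _
  set z : ℕ → ℝ := fun k => ‖s.z k (act k)‖ with hz
  set i₀ := Classical.arbitrary V
  -- a bound of the initial errors which is free of the horizon `N` chosen below
  obtain ⟨R, hR⟩ : ∃ R : ℝ, ∀ k ≤ K + K, ‖s.x k i₀ - xs‖ + c k + t k ≤ R := by
    refine ⟨∑ k ∈ range (K + K + 1), (‖s.x k i₀ - xs‖ + c k + t k), fun k hk => ?_⟩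
    exact single_le_sum (f := fun k => ‖s.x k i₀ - xs‖ + c k + t k)
      (fun k _ => add_nonneg (add_nonneg (norm_nonneg _) (hc0 k)) (ht0 k))
      (mem_range.2 (by omega))
  obtain ⟨B, hB⟩ := H γ hγ hγ1 R K
  refine IsBigO.of_bound (Real.sqrt (Fintype.card V) * B) (Eventually.of_forall fun N => ?_)
  obtain ⟨xbar, ψ, hcons, hψ⟩ := hs.exists_average hloop hconn hm hD hWA hmodel N
  set p : ℕ → ℝ := fun k => ‖xbar k - xs‖ with hp
  have hdist : ∀ k i, ‖s.x k i - xs‖ ≤ p k + c k := by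
    intro k i
    have := norm_sub_le_norm_sub_add_norm_sub (s.x k i) (xbar k) xs
    have h1 := hcons k i
    rw [norm_sub_rev] at h1
    simp only [hp, hc]
    linarith
  have hgle : ∀ k, ‖∑ j, gradient (f j) (s.x k j)‖ ≤ Λ * (p k + c k) := by
    intro k
    have := norm_sum_gradient_sub_le hlip (a := s.x k) (b := fun _ => xs) (hdist k)
    rwa [hxs, sub_zero] at this
  have hzle : ∀ k, z k ≤ Λ * (p k + c k) + t k := by
    intro k
    have h1 := hzξ k (act k)
    have h2 := norm_sub_norm_le (s.z k (act k))
      (ξ k (act k) • ∑ j, gradient (f j) (s.x k j))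
    rw [norm_smul, Real.norm_of_nonneg (hξ _ _).1] at h2
    have h3 := mul_le_of_le_one_left (norm_nonneg (∑ j, gradient (f j) (s.x k j)))
      (hξ k (act k)).2
    have h4 := hgle k
    simp only [hz]
    linarith
  have hstep : ∀ k, K ≤ k → k < N →
      p (k + 1) ≤ (1 - 3 / 4 * (τ * η ^ 2) * γ) * p k + γ * (Λ * c k + t k) := by
    intro k hkK hkN
    obtain ⟨hψ0, hψ1, hxbar⟩ := hψ k hkN
    obtain ⟨hξ0, hξ1⟩ := hξ k (act k)
    have hξη := hξη k (act k) hkK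
    set α := γ * (ψ k * ξ k (act k)) with hα
    have hψ00 : 0 ≤ ψ k := hη0.le.trans hψ0
    have hψξ : η ^ 2 ≤ ψ k * ξ k (act k) := by rw [sq]; gcongr
    have hψξ1 : ψ k * ξ k (act k) ≤ 1 := mul_le_one₀ hψ1 hξ0 hξ1
    have hα0 : 0 ≤ α := by positivity
    have hαγ : α ≤ γ := mul_le_of_le_one_right hγ.le hψξ1
    set gx := ∑ j, gradient (f j) (xbar k) with hgx
    set g := ∑ j, gradient (f j) (s.x k j) with hg
    have hcontr : ‖xbar k - α • gx - xs‖ ≤ (1 - 3 / 4 * τ * α) * p k :=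
      norm_gradient_step_le hconv hgrad hxs hgradΛ hα0
        ((mul_le_mul_of_nonneg_right hαγ hτ.le).trans hγτ)
        ((mul_le_mul_of_nonneg_right hαγ (sq_nonneg _)).trans hγΛ) (xbar k)
    have hgdiff : ‖gx - g‖ ≤ Λ * c k :=
      norm_sum_gradient_sub_le hlip (a := fun _ => xbar k) (b := s.x k) (hcons k)
    have hsplit : xbar (k + 1) - xs = (xbar k - α • gx - xs) + α • (gx - g) -
        (γ * ψ k) • (s.z k (act k) - ξ k (act k) • g) := by
      rw [hxbar, smul_sub, smul_sub, smul_smul, hα, mul_assoc γ]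
      abel
    have h1 : ‖α • (gx - g)‖ ≤ γ * (Λ * c k) := by
      rw [norm_smul, Real.norm_of_nonneg hα0]
      gcongr
    have h2 : ‖(γ * ψ k) • (s.z k (act k) - ξ k (act k) • g)‖ ≤ γ * t k := by
      rw [norm_smul, Real.norm_of_nonneg (by positivity)]
      have := hzξ k (act k)
      have h3 : γ * ψ k ≤ γ := mul_le_of_le_one_right hγ.le hψ1
      gcongr
    have h3 : (1 - 3 / 4 * τ * α) * p k ≤ (1 - 3 / 4 * (τ * η ^ 2) * γ) * p k := by
      have : τ * (γ * η ^ 2) ≤ τ * α := by rw [hα]; gcongr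
      exact mul_le_mul_of_nonneg_right (by linarith) (norm_nonneg _)
    calc p (k + 1) ≤ ‖xbar k - α • gx - xs‖ + ‖α • (gx - g)‖ +
          ‖(γ * ψ k) • (s.z k (act k) - ξ k (act k) • g)‖ := by
          simp only [hp]
          rw [hsplit]
          exact (norm_sub_le _ _).trans (add_le_add (norm_add_le _ _) le_rfl)
      _ ≤ _ := by linarith
  have hfinal := hB N p c t z ?_ hstep
    (fun k => hs.diam_consensusState_le hloop hconn hm hD hWA hmodel hγ k) ?_ hzle N le_rfl
  · have h1 := distToConsensus_le (s.x N) xs (hdist N)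
    have h2 : 0 ≤ distToConsensus (s.x N) xs := Real.sqrt_nonneg _
    rw [Real.norm_of_nonneg h2, mul_assoc]
    refine h1.trans (mul_le_mul_of_nonneg_left (hfinal.trans ?_) (Real.sqrt_nonneg _))
    have : τ * η ^ 2 * γ ≤ 1 := (mul_le_mul_of_nonneg_left hγ1 (by positivity)).trans hμγ₁
    rw [Real.norm_of_nonneg (pow_nonneg (by linarith) _)]
  · intro k hk
    have h1 := hR k hk
    have h2 := norm_nonneg (s.x k i₀ - xs)
    have h3 := norm_sub_le_norm_sub_add_norm_sub (xbar k) (s.x k i₀) xs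
    have h4 := hcons k i₀
    have h5 := hc0 k
    have h6 := ht0 k
    simp only [hp, hc] at *
    refine ⟨by linarith, by linarith, by linarith⟩
  · intro k
    refine (ht k).trans (add_le_add le_rfl (sum_le_sum fun m _ => ?_))
    refine mul_le_mul_of_nonneg_left ?_ zero_le_two
    refine ((hlip _).norm_sub_le _ _).trans ?_
    have h1 := hs.norm_x_succ_sub_le hloop hm hD hWA hmodel hγ (k + m)
    have h2 : (L (act (k + m)) : ℝ) ≤ Λ :=
      single_le_sum (f := fun i => (L i : ℝ)) (fun i _ => (L i).2) (mem_univ _)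
    gcongr

lemma rhoConst_mem {mbar : ℝ} (hm : 0 < mbar) (hm1 : mbar ≤ 1) {T D : ℕ} (hD : 0 < D) :
    0 ≤ rhoConst mbar (Fintype.card V) T D ∧ rhoConst mbar (Fintype.card V) T D < 1 := by
  have hη0 : 0 < eta mbar (Fintype.card V) T D := pow_pos hm _
  have hη1 : eta mbar (Fintype.card V) T D ≤ 1 := pow_le_one₀ hm.le hm1
  have hK : 0 < K1 (Fintype.card V) T D := K1_pos hD
  refine ⟨Real.rpow_nonneg (by linarith) _, Real.rpow_lt_one (by linarith) (by linarith) ?_⟩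
  positivity

end Rate

/-- The curves `γ ↦ 1 - b * γ` and `γ ↦ ρ + (1 - ρ) * √(γ / γ₂)` cross between `0` and `γ₂`, and the
second one is above the first one from there on. -/
lemma exists_rate_crossing {ρ b γ₂ : ℝ} (hρ : ρ < 1) (hb : 0 < b) (hγ₂ : 0 < γ₂) :
    ∃ γ₁, 0 < γ₁ ∧ γ₁ < γ₂ ∧ ∀ γ, γ₁ ≤ γ →
      1 - b * γ ≤ ρ + Real.sqrt ((1 - ρ) ^ 2 / γ₂ * γ) := by
  have hcont : ContinuousOn (fun γ => ρ + Real.sqrt ((1 - ρ) ^ 2 / γ₂ * γ) - (1 - b * γ))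
      (Set.Icc 0 γ₂) := by fun_prop
  have h0 : ρ + Real.sqrt ((1 - ρ) ^ 2 / γ₂ * 0) - (1 - b * 0) < 0 := by simpa using hρ
  have h2 : 0 < ρ + Real.sqrt ((1 - ρ) ^ 2 / γ₂ * γ₂) - (1 - b * γ₂) := by
    rw [div_mul_cancel₀ _ hγ₂.ne', Real.sqrt_sq (by linarith)]
    have := mul_pos hb hγ₂
    linarith
  obtain ⟨γ₁, ⟨h3, h4⟩, h5⟩ := intermediate_value_Icc hγ₂.le hcont ⟨h0.le, h2.le⟩
  simp only at h5
  refine ⟨γ₁, h3.lt_of_ne ?_, h4.lt_of_ne ?_, fun γ hγ => ?_⟩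
  · rintro rfl; linarith
  · rintro rfl; linarith
  · have h6 : Real.sqrt ((1 - ρ) ^ 2 / γ₂ * γ₁) ≤ Real.sqrt ((1 - ρ) ^ 2 / γ₂ * γ) := by gcongr
    have h7 : b * γ₁ ≤ b * γ := by gcongr
    linarith

end AsySonata

theorem theorem2 {V : Type*} [Fintype V] [Nonempty V] (G : Digraph V)
    (hloop : NoSelfLoops G) (hconn : StronglyConnected G)
    (mbar : ℝ) (hmbar : 0 < mbar) (T D : ℕ) (hT : 0 < T) (hD : 0 < D)
    (L : V → ℝ≥0) (τ : ℝ) (hτ : 0 < τ) :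
    ∃ γbar γ₁ γ₂ : ℝ, 0 < γ₁ ∧ γ₁ < γ₂ ∧ γ₂ < γbar ∧
    ∃ rate : ℝ → ℝ,
      (∀ γ ∈ Set.Ioc 0 γ₁, rate γ = 1 - τ * eta mbar (Fintype.card V) T D ^ 2 * γ / 2) ∧
      (∀ γ ∈ Set.Ioo γ₁ γ₂, rate γ = rhoConst mbar (Fintype.card V) T D +
        Real.sqrt ((1 - rhoConst mbar (Fintype.card V) T D) ^ 2 / γ₂ * γ)) ∧
      ∀ W A : Matrix V V ℝ, Weights G mbar W A →
        (∀ γ ∈ Set.Ioc 0 γbar, rate γ ∈ Set.Ioo 0 1) ∧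
        ∀ (n : ℕ) (f : V → EuclideanSpace ℝ (Fin n) → ℝ),
          (∀ i, Differentiable ℝ (f i)) →
          (∀ i, LipschitzWith (L i) (gradient (f i))) →
          StrongConvexOn Set.univ τ (fun x => ∑ i, f i x) →
          ∃ xs : EuclideanSpace ℝ (Fin n),
            (∀ y, IsMinOn (fun x => ∑ i, f i x) Set.univ y ↔ y = xs) ∧
            ∀ (act : ℕ → V) (d : ℕ → V → ℕ), AsyncModel G T D act d →
            ∀ γ ∈ Set.Ioc 0 γbar, ∀ s : Variables V (EuclideanSpace ℝ (Fin n)),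
              IsGenerated G W A f D (fun _ => γ) act d s →
              (fun k : ℕ => distToConsensus (s.x k) xs) =O[atTop] (fun k : ℕ => rate γ ^ k) := by
  -- the two formulas for the rate leave its values from `γ₂` on free: the first one is valid there
  let rateOf (γ₁ γ₂ γ : ℝ) : ℝ :=
    if γ ≤ γ₁ then 1 - τ * eta mbar (Fintype.card V) T D ^ 2 * γ / 2
    else if γ < γ₂ then rhoConst mbar (Fintype.card V) T D +
      Real.sqrt ((1 - rhoConst mbar (Fintype.card V) T D) ^ 2 / γ₂ * γ)
    else 1 - τ * eta mbar (Fintype.card V) T D ^ 2 * γ / 2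
  have hlow : ∀ γ₁ γ₂, ∀ γ ∈ Set.Ioc 0 γ₁,
      rateOf γ₁ γ₂ γ = 1 - τ * eta mbar (Fintype.card V) T D ^ 2 * γ / 2 :=
    fun γ₁ γ₂ γ hγ => if_pos hγ.2
  have hmid : ∀ γ₁ γ₂, ∀ γ ∈ Set.Ioo γ₁ γ₂, rateOf γ₁ γ₂ γ = rhoConst mbar (Fintype.card V) T D +
      Real.sqrt ((1 - rhoConst mbar (Fintype.card V) T D) ^ 2 / γ₂ * γ) :=
    fun γ₁ γ₂ γ hγ => (if_neg (not_le.2 hγ.1)).trans (if_pos hγ.2)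
  rcases le_or_gt mbar 1 with hm1 | hm1
  swap
  · -- there are no weights: a diagonal entry of `W` is at most `1`
    refine ⟨3, 1, 2, one_pos, one_lt_two, by norm_num, rateOf 1 2, hlow _ _, hmid _ _, ?_⟩
    intro W A hWA
    exact absurd (hWA.compliantW.le_one hmbar hWA.rowStochastic) (not_le.2 hm1)
  obtain ⟨γbar, hγbar, hηγ, H⟩ := exists_stepsize_isBigO G hloop hconn hmbar hm1 T hD L hτ
  obtain ⟨hρ0, hρ1⟩ := rhoConst_mem (V := V) hmbar hm1 (T := T) hD
  set η := eta mbar (Fintype.card V) T D with hη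
  set ρ := rhoConst mbar (Fintype.card V) T D with hρ
  have hη0 : 0 < η := pow_pos hmbar _
  obtain ⟨γ₁, hγ₁, hγ₁₂, hcross⟩ := exists_rate_crossing hρ1 (b := τ * η ^ 2 / 2) (by positivity)
    (half_pos hγbar)
  have hpos : ∀ γ ∈ Set.Ioc 0 γbar, 0 < 1 - τ * η ^ 2 * γ / 2 := by
    intro γ hγ
    have : τ * η ^ 2 * γ ≤ τ * η ^ 2 * γbar := by gcongr; exact hγ.2
    linarith
  have hle : ∀ γ ∈ Set.Ioc 0 γbar, 1 - τ * η ^ 2 * γ / 2 ≤ rateOf γ₁ (γbar / 2) γ := by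
    intro γ hγ
    simp only [rateOf]
    split_ifs with h1 h2
    · exact le_rfl
    · have := hcross γ (not_le.1 h1).le
      linarith
    · exact le_rfl
  refine ⟨γbar, γ₁, γbar / 2, hγ₁, hγ₁₂, half_lt_self hγbar, rateOf γ₁ (γbar / 2), hlow _ _,
    hmid _ _, ?_⟩
  intro W A hWA
  refine ⟨fun γ hγ => ⟨(hpos γ hγ).trans_le (hle γ hγ), ?_⟩, ?_⟩
  · have hlt : 1 - τ * η ^ 2 * γ / 2 < 1 := by
      have := hγ.1
      have : 0 < τ * η ^ 2 * γ := by positivity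
      linarith
    simp only [rateOf]
    split_ifs with h1 h2
    · exact hlt
    · have h3 : Real.sqrt ((1 - ρ) ^ 2 / (γbar / 2) * γ) < 1 - ρ := by
        rw [Real.sqrt_lt' (by linarith), div_mul_eq_mul_div, div_lt_iff₀ (half_pos hγbar)]
        exact mul_lt_mul_of_pos_left h2 (pow_pos (by linarith) 2)
      linarith
    · exact hlt
  intro n f hdiff hlip hconv
  have hgrad : ∀ x, HasGradientAt (fun x => ∑ i, f i x) (∑ i, gradient (f i) x) x := fun x =>
    hasGradientAt_sum _ fun i _ => (hdiff i x).hasGradientAt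
  obtain ⟨xs, hmin, hxs⟩ := exists_unique_minimizer hτ hconv hgrad
  refine ⟨xs, hmin, fun act d hmodel γ hγ s hs => ?_⟩
  refine (H W A hWA n f hdiff hlip hconv xs hxs act d hmodel γ hγ.1 hγ.2 s hs).trans
    (IsBigO.of_bound 1 (Eventually.of_forall fun k => ?_))
  rw [norm_pow, norm_pow, one_mul, Real.norm_of_nonneg (hpos γ hγ).le,
    Real.norm_of_nonneg ((hpos γ hγ).le.trans (hle γ hγ))]
  exact pow_le_pow_left₀ (hpos γ hγ).le (hle γ hγ) k
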